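/- **Setting.** Let $\ell\neq 0$ be an integer and $\xi^x=\exp(2i\pi x/\ell)$. Let $\Lambda$ be a free abelian group of rank $r$, $\Lambda^*=\mathrm{Hom}(\Lambda,\mathbb Z)$, $\mathfrak H=\Lambda^*\otimes\mathbb C$ with basis $H_1,\dots,H_r$ coming from a basis of $\Lambda^*$, $G=\mathfrak H^*/\Lambda$ and $G'=\mathfrak H/\Lambda^*$. Let $\mathcal U=W\otimes\mathbb C[\Lambda^*]$ ($W$ a finite dimensional $\Lambda$-graded space with a distinguished element $1_W$ of degree $0$) be a $\Lambda$-graded pivotal Hopf algebra with pivot $g$ that extends the Hopf algebra $\mathbb C[\Lambda^*]=1_W\otimes \mathbb C[\Lambda^*]$ of group-like elements $K^a$, with $K^axK^{-a}=\xi^{a(|x|)}x$ for homogeneous $x\in W$. Let $\mathcal U^H=\mathcal U\rtimes S\mathfrak H$, with $[H_a,x]=a(|x|)x$ for homogeneous $x\in\mathcal U$, be the unrolled algebra. Let $(\mathcal U^H)^{\widehat\otimes k}\simeq W^{\otimes k}\otimes\mathscr C^\omega((\mathfrak H^*)^k)$ be the completed tensor powers, in which $K^a=\xi^{H_a}$;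 write $H_{i,j}$ for $H_i$ in the $j$-th factor and $h_j=(H_{1,j},\dots,H_{r,j})$. Let $\mathsf Q\in\Lambda^*\otimes\Lambda^*$ be symmetric and let $\check{\mathcal R}\in\mathcal U\otimes\mathcal U$ be a quasi R-matrix for $\mathsf Q$. That is, $\check{\mathcal R}$ is invertible and, with $B_\lambda=\mathsf Q(\lambda,\cdot)\in\Lambda^*$ regarded as the element $K^{B_\lambda}\in\mathcal U$, with $\widetilde{\mathcal H}(x\otimes y)=xB_{|y|}\otimes B_{|x|}y$, and with $\check{\mathcal R}=\sum_i x_i\otimes y_i$ for homogeneous $x_i,y_i$: $\tau(\Delta u)=\widetilde{\mathcal H}(\check{\mathcal R}\,\Delta u\,\check{\mathcal R}^{-1})$ for $u\in\mathcal U^H$, $(\Delta\otimes\mathrm{Id})\check{\mathcal R}=\big(\sum_i x_i\otimes B_{|y_i|}^{-1}\otimes y_i\big)\check{\mathcal R}_{23}$, $(\mathrm{Id}\otimes\Delta)\check{\mathcal R}=\big(\sum_i x_i\otimes B_{|x_i|}^{-1}\otimes y_i\big)\check{\mathcal R}_{12}$ and $\sum_i y_igx_iB_{|x_i|}=\sum_i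 x_ig^{-1}y_iB_{|x_i|}^{-1}$. Put $\mathcal R=\xi^{\mathsf Q}\check{\mathcal R}=\sum a\otimes b$. A weight module is a finite dimensional $\mathcal U^H$-module on which $S\mathfrak H$ is semisimple and $K^a=\xi^{H_a}$; it is homogeneous of degree $\bar\beta\in G$ if all its weights lie in $\bar\beta$. **Graphs.** An $n$-string link graph is a ribbon graph in $\mathbb R^2\times[0,1]$ with red and blue edges such that: the first $k$ bottom legs and the first $k$ top legs of every coupon are red and directed upwards ($k$ depends on the coupon) and its other legs are blue; the first $n$ bottom and the first $n$ top boundary points are red and the others are blue; and, after each coupon has been smoothed (its red legs are joined into $k$ parallel vertical strings), the red part consists of $n$ open strands, the $i$-th of which goes upwards from the $i$-th bottom point to the $i$-th top point, and of closed components. Blue edges are colored by weight modules. A coupon with $k$ red legs is colored by an element $f$ of $\xi^{q+l}\,\mathcal U^{\otimes k}\otimes\mathrm{Hom}_{\mathbb C}(V_c,V_c')$ that acts as a $\mathcal U^H$-morphism $(\mathcal U^H)^{\widehat\otimes k}\otimes V_c\to(\mathcal U^H)^{\widehat\otimes k}\otimes V_c'$, where $V_c$, $V'_c$ are the tensor products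 of the colors of its blue bottom and top legs (dual modules for legs directed downwards), $q$ is an integral quadratic form in the $H_{i,j}$ and $l$ is a complex linear form in them; $(q,\bar l)$, with $\bar l\in (G')^k$ the class of $l$, is an exponent of $f$. The graph is homogeneous if every blue edge $s$ is colored by a homogeneous module, of degree $\bar\beta_s\in G$. **The element $J_D^b$.** Let $D$ be a planar diagram of a homogeneous $n$-string link graph with $m$ closed red components, and let $b$ be the choice of a base point on each of them. Number the red components $1,\dots,m+n$ (closed ones first). Place beads on $D$ as follows, where $S^{\downarrow}(x)$ is $x$ on upward strands and $S(x)$ on downward strands. At each crossing the upper strand carries $S^\downarrow(a)$; the lower strand carries $S^\downarrow(b)$ if the upper strand goes between the bottom left and the top right, and $S^\downarrow(S^{-1}(b))$ otherwise. Each cap directed to the right carries $g$, each cup directed to the right $g^{-1}$, the other caps and cups carry $1$. Each coupon is smoothed, with the components in $(\mathcal U^H)^{\widehat\otimes k}$ of its color put on its red strings. Multiply the beads on each red component in the order opposite to its direction (starting from the base point if it is closed), let the beads on a blue strand colored by $V$ act on $V$ (by the transposed action on $V^*$ if the strand is directed downwards), and evaluate the blue part by the Penrose graphical calculus of vector spaces.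 The result is $$J_D^b\in(\mathcal U^H)^{\widehat\otimes (m+n)}\otimes\mathrm{Hom}_{\mathbb C}(V,V'),$$ where $V$, $V'$ are the tensor products of the colors of the blue bottom and top boundary points. **The exponent.** Let $\mathrm{lk}_{ks}$ be the sum of the signs of the crossings of $D$ at which $s$ passes above $k$, where $k,s$ are red components or blue edges. Put $$\mathsf Q_D=\sum_{1\le k,s\le m+n}\mathrm{lk}_{ks}\,\mathsf Q(h_k,h_s),\qquad \overline L_D=\sum_{1\le k\le m+n}\ \sum_{s\text{ blue}}(\mathrm{lk}_{ks}+\mathrm{lk}_{sk})\,\mathsf Q(\bar\beta_s,h_k)\in(G')^{m+n},$$ $$\mathsf Q_D^c=\sum_{c}q_c(h_{i_1},\dots,h_{i_k}),\qquad \overline L{}_D^c=\sum_{c} \bar l_c(h_{i_1},\dots,h_{i_k})\in(G')^{m+n},$$ where $c$ runs over the coupons, $(q_c,\bar l_c)$ is an exponent of the color of $c$, and $i_1,\dots,i_k$ are the red components passing through the red legs of $c$. **Theorem.** Let $L_D$ and $L_D^c$ be any representatives of $\overline L_D$ and $\overline L{}_D^c$ in $\mathfrak H^{m+n}$, and let $P_D=\mathsf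 Q_D+\mathsf Q_D^c+L_D+L_D^c$. Then $\xi^{P_D}$ does not depend on the choice of these representatives up to multiplication by a unit of $\mathcal U^{\otimes (m+n)}$ of the form $\xi^{\sum a_{i,j}H_{i,j}}$ with $a_{i,j}\in\mathbb Z$, and $$J_D^b\in\xi^{P_D}\,\mathcal U^{\otimes (m+n)}\otimes\mathrm{Hom}_{\mathbb C}(V,V').$$ -/

import Mathlib

open scoped TensorProduct
open Module

namespace Unrolled

noncomputable section

/-! ### The Hopf algebra `𝒰` and its quasi R-matrix

The lattice is `Λ = ℤ^r` and its dual is `Λ* = ℤ^r`, with the dot product as pairing; `𝔥 = Λ* ⊗ ℂ`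
and `𝔥* = Λ ⊗ ℂ` are both written `Fin r → ℂ`. -/

/-- `ξ^x = exp (2 i π x / ℓ)`. -/
def xiPow (ℓ : ℤ) (x : ℂ) : ℂ := Complex.exp (2 * Real.pi * Complex.I * x / ℓ)

/-- The pairing of `a ∈ Λ*` with a point of `𝔥*`. -/
def pair {r : ℕ} (a : Fin r → ℤ) (z : Fin r → ℂ) : ℂ := ∑ i, (a i : ℂ) * z i

/-- The image in `𝔥*` of an element of the lattice `Λ`. -/
def latt {r : ℕ} (a : Fin r → ℤ) : Fin r → ℂ := fun i => (a i : ℂ)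

/-- The part of degree `lam`, where the basis vector indexed by `(i, a)` has degree `wt i`. -/
def homPart {r : ℕ} {ι U : Type*} [AddCommGroup U] [Module ℂ U]
    (b : Basis (ι × (Fin r → ℤ)) ℂ U) (wt : ι → Fin r → ℤ) (lam : Fin r → ℤ) : Submodule ℂ U :=
  Submodule.span ℂ (b '' {p | wt p.1 = lam})

/-- A `Λ`-graded pivotal Hopf algebra `U` with underlying vector space `W ⊗ ℂ[Λ*]`, extending
the Hopf algebra `ℂ[Λ*] = 1_W ⊗ ℂ[Λ*]`, with `K^a x K^{-a} = ξ^{a(|x|)} x` for homogeneous `x ∈ W`.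
The finite type `ι` indexes a homogeneous basis `w i` of `W` which contains `1_W`; the basis vector
of `U` indexed by `(i, a)` is `w i * K^a`. -/
structure UnrolledHopf (r : ℕ) (ℓ : ℤ) (ι U : Type*) [Fintype ι] [DecidableEq ι]
    [Ring U] [HopfAlgebra ℂ U] where
  /-- `K a` is the group-like element `K^a`. -/
  K : Multiplicative (Fin r → ℤ) →* U
  basis : Basis (ι × (Fin r → ℤ)) ℂ U
  /-- the degree of `w i` -/
  wt : ι → Fin r → ℤ
  /-- the index of `1_W` -/
  one : ι
  basis_one : basis (one, 0) = 1
  wt_one : wt one = 0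
  basis_mul : ∀ i a, basis (i, a) = basis (i, 0) * K (Multiplicative.ofAdd a)
  K_groupLike : ∀ a, IsGroupLikeElem ℂ (K a)
  K_conj : ∀ (a : Fin r → ℤ) (i : ι),
    K (Multiplicative.ofAdd a) * basis (i, 0) * K (Multiplicative.ofAdd (-a)) =
      xiPow ℓ (pair a (latt (wt i))) • basis (i, 0)
  mul_mem : ∀ lam mu x y, x ∈ homPart basis wt lam → y ∈ homPart basis wt mu →
    x * y ∈ homPart basis wt (lam + mu)
  comul_mem : ∀ lam x, x ∈ homPart basis wt lam →
    Coalgebra.comul (R := ℂ) x ∈ ⨆ mu : Fin r → ℤ, LinearMap.range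
      (TensorProduct.map (homPart basis wt mu).subtype (homPart basis wt (lam - mu)).subtype)
  counit_eq_zero : ∀ lam x, lam ≠ 0 → x ∈ homPart basis wt lam → Coalgebra.counit (R := ℂ) x = 0
  antipode_mem : ∀ lam x, x ∈ homPart basis wt lam →
    HopfAlgebra.antipode ℂ x ∈ homPart basis wt lam
  /-- the pivot `g` -/
  pivot : Uˣ
  pivot_groupLike : IsGroupLikeElem ℂ (pivot : U)
  antipode_sq : ∀ x : U, HopfAlgebra.antipode ℂ (HopfAlgebra.antipode ℂ x) =
    pivot * x * (pivot⁻¹ : Uˣ)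

section

variable {r : ℕ} {ℓ : ℤ} {ι U : Type*} [Fintype ι] [DecidableEq ι] [Ring U] [HopfAlgebra ℂ U]

namespace UnrolledHopf

/-- The basis vector `w i` of `W ⊆ U`. -/
def w (A : UnrolledHopf r ℓ ι U) (i : ι) : U := A.basis (i, 0)

/-- `K^a`, in additive notation for `a ∈ Λ*`. -/
def Kadd (A : UnrolledHopf r ℓ ι U) (a : Fin r → ℤ) : U := A.K (Multiplicative.ofAdd a)

/-- The inverse of the antipode, `S⁻¹(x) = g⁻¹ S(x) g`. -/
def antipodeInv (A : UnrolledHopf r ℓ ι U) : U →ₗ[ℂ] U :=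
  LinearMap.mulLeft ℂ ((A.pivot⁻¹ : Uˣ) : U) ∘ₗ LinearMap.mulRight ℂ (A.pivot : U) ∘ₗ
    HopfAlgebra.antipode ℂ

/-- `u ∈ U` is sent to `∑ i, w i * f i` with `f i` an entire function on `𝔥*`, through
`K^a ↦ ξ^a`; then `A.coef i z u` is `f i z`. -/
def coef (A : UnrolledHopf r ℓ ι U) (i : ι) (z : Fin r → ℂ) : U →ₗ[ℂ] ℂ :=
  A.basis.constr ℂ fun p => if p.1 = i then xiPow ℓ (pair p.2 z) else 0

/-- The linear endomorphisms of (or maps on) `U ⊗ U` that are given by a formula on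
homogeneous `x ⊗ y`: `F x y |x| |y|`. -/
def onHomogeneous (A : UnrolledHopf r ℓ ι U) {M : Type*} [AddCommGroup M] [Module ℂ M]
    (F : U → U → (Fin r → ℤ) → (Fin r → ℤ) → M) : U ⊗[ℂ] U →ₗ[ℂ] M :=
  (A.basis.tensorProduct A.basis).constr ℂ fun p =>
    F (A.basis p.1) (A.basis p.2) (A.wt p.1.1) (A.wt p.2.1)

end UnrolledHopf

/-- A symmetric `Q ∈ Λ* ⊗ Λ*` together with a quasi R-matrix for it. Here `B lam = Q(lam, ·) ∈ Λ*`;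
the first relation is required for all elements of `𝒰^H`, that is for those of `U`
(`comul_op`) and for those of `𝔥` (`deg_zero`: the quasi R-matrix commutes with
`H ⊗ 1 + 1 ⊗ H`, so it has total degree zero). -/
structure QuasiRMatrix (A : UnrolledHopf r ℓ ι U) where
  Q : Matrix (Fin r) (Fin r) ℤ
  symm : Q.IsSymm
  R : (U ⊗[ℂ] U)ˣ
  comul_op : ∀ u : U, TensorProduct.comm ℂ U U (Coalgebra.comul (R := ℂ) u) =
    A.onHomogeneous
      (fun x y dx dy => (x * A.Kadd (Q.mulVec dy)) ⊗ₜ[ℂ] (A.Kadd (Q.mulVec dx) * y))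
      (R * Coalgebra.comul (R := ℂ) u * (R⁻¹ : (U ⊗[ℂ] U)ˣ))
  deg_zero : (R : U ⊗[ℂ] U) ∈ ⨆ mu : Fin r → ℤ, LinearMap.range
    (TensorProduct.map (homPart A.basis A.wt mu).subtype (homPart A.basis A.wt (-mu)).subtype)
  comul_left : (Coalgebra.comul (R := ℂ) (A := U)).rTensor U (R : U ⊗[ℂ] U) =
    A.onHomogeneous (fun x y _ dy => (x ⊗ₜ[ℂ] A.Kadd (-(Q.mulVec dy))) ⊗ₜ[ℂ] y) R *
    A.onHomogeneous (fun x y _ _ => ((1 : U) ⊗ₜ[ℂ] x) ⊗ₜ[ℂ] y) R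
  comul_right : (TensorProduct.assoc ℂ U U U).symm
      ((Coalgebra.comul (R := ℂ) (A := U)).lTensor U (R : U ⊗[ℂ] U)) =
    A.onHomogeneous (fun x y dx _ => (x ⊗ₜ[ℂ] A.Kadd (-(Q.mulVec dx))) ⊗ₜ[ℂ] y) R *
    A.onHomogeneous (fun x y _ _ => (x ⊗ₜ[ℂ] y) ⊗ₜ[ℂ] (1 : U)) R
  twist : A.onHomogeneous
      (fun x y dx _ => y * (A.pivot : U) * x * A.Kadd (Q.mulVec dx)) R =
    A.onHomogeneous
      (fun x y dx _ => x * ((A.pivot⁻¹ : Uˣ) : U) * y * A.Kadd (-(Q.mulVec dx))) R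

/-! ### Completed tensor powers

For a finite type `B`, an element of `(𝒰^H)^{⊗̂ B} ⊗ E = W^{⊗ B} ⊗ 𝒞^ω((𝔥*)^B) ⊗ E` is written
`∑ I, w_I * f_I`, with `w_I = ⊗ b, w (I b)`, and is represented by the family
of the `E`-valued functions `f_I` on `(𝔥*)^B`. -/

/-- Families of `E`-valued functions on `(𝔥*)^B`, indexed by the basis of `W^{⊗ B}`. -/
abbrev Hat (_A : UnrolledHopf r ℓ ι U) (B E : Type*) := (B → ι) → (B → Fin r → ℂ) → E

/-- The elements of the completed tensor power, tensored with a space of matrices: those families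
whose functions are entire. -/
def IsEntire {A : UnrolledHopf r ℓ ι U} {B σ τ : Type*} [Fintype B]
    (x : Hat A B (Matrix σ τ ℂ)) : Prop :=
  ∀ I s t, Differentiable ℂ fun z : B → Fin r → ℂ => x I z s t

/-- The embedding of `U^{⊗ B}` in the completion. -/
def toHat (A : UnrolledHopf r ℓ ι U) {B : Type*} [Fintype B] (u : ⨂[ℂ] _ : B, U) : Hat A B ℂ :=
  fun I z => PiTensorProduct.lift
    ((MultilinearMap.mkPiAlgebra ℂ B ℂ).compLinearMap fun b => A.coef (I b) (z b)) u

/-- Left multiplication by a function `F` of the Cartan variables; `F(h) w = w F(h + |w|)`. -/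
def cartanMul (A : UnrolledHopf r ℓ ι U) {B : Type*} (F : (B → Fin r → ℂ) → ℂ)
    (x : Hat A B ℂ) : Hat A B ℂ :=
  fun I z => F (fun b => z b + latt (A.wt (I b))) * x I z

/-- A function of the Cartan variables as an element of the completion. -/
def cartan (A : UnrolledHopf r ℓ ι U) {B : Type*} [Fintype B] (F : (B → Fin r → ℂ) → ℂ) :
    Hat A B ℂ :=
  fun I z => if ∀ b, I b = A.one then F z else 0

/-- The subspace `ξ^P U^{⊗ B} ⊗ E` for `E` a space of matrices. -/
def powerSpace (A : UnrolledHopf r ℓ ι U) {B : Type*} [Fintype B] (P : (B → Fin r → ℂ) → ℂ)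
    (σ τ : Type*) : Submodule ℂ (Hat A B (Matrix σ τ ℂ)) :=
  Submodule.span ℂ {x | ∃ (u : ⨂[ℂ] _ : B, U) (f : Matrix σ τ ℂ),
    x = fun I z => cartanMul A (fun z => xiPow ℓ (P z)) (toHat A u) I z • f}

/-- The antipode, or its inverse (according to the map `S` on `U`), on the factor `b`:
`w f(h) ↦ f(-h) S(w)`. -/
def antipodeAt (A : UnrolledHopf r ℓ ι U) {B : Type*} [DecidableEq B] (S : U →ₗ[ℂ] U) (b : B)
    (x : Hat A B ℂ) : Hat A B ℂ :=
  fun I z => ∑ i, A.coef (I b) (z b) (S (A.w i)) *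
    x (Function.update I b i) (Function.update z b (-(z b + latt (A.wt (I b)))))

/-- The product `x * y` for matrix-valued elements:
`w_I f(h) w_J f'(h) = w_I w_J f(h + |w_J|) f'(h)`. -/
def hatMul {A : UnrolledHopf r ℓ ι U} {B ρ σ τ : Type*} [Fintype B] [DecidableEq B] [Fintype σ]
    (x : Hat A B (Matrix ρ σ ℂ)) (y : Hat A B (Matrix σ τ ℂ)) : Hat A B (Matrix ρ τ ℂ) :=
  fun L z => ∑ I : B → ι, ∑ J : B → ι, (∏ b, A.coef (L b) (z b) (A.w (I b) * A.w (J b))) •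
    (x I (fun b => z b + latt (A.wt (J b))) * y J z)

/-- The integral quadratic element with coefficient matrix `M`, as a function on `(𝔥*)^B`. -/
def quad {r : ℕ} {B : Type*} [Fintype B] (M : Matrix (B × Fin r) (B × Fin r) ℤ)
    (z : B → Fin r → ℂ) : ℂ :=
  ∑ p, ∑ q, (M p q : ℂ) * z p.1 p.2 * z q.1 q.2

/-- The linear element `∑ l_{b,i} H_{i,b}`, as a function on `(𝔥*)^B`. -/
def lin {r : ℕ} {B : Type*} [Fintype B] (l : B → Fin r → ℂ) (z : B → Fin r → ℂ) : ℂ :=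
  ∑ b, ∑ i, l b i * z b i

/-- `Q(h, h')`, for `Q ∈ Λ* ⊗ Λ*`. -/
def bil {r : ℕ} (Q : Matrix (Fin r) (Fin r) ℤ) (z z' : Fin r → ℂ) : ℂ :=
  ∑ i, ∑ j, (Q i j : ℂ) * z i * z' j

/-- `ℂ / ℤ`; thus `G = 𝔥* / Λ` and `G' = 𝔥 / Λ*` are both `Fin r → CModZ`. -/
abbrev CModZ := ℂ ⧸ AddSubgroup.zmultiples (1 : ℂ)

/-- The class in `ℂ / ℤ`. -/
def cls (x : ℂ) : CModZ := QuotientAddGroup.mk x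

/-- The universal R-matrix `ξ^Q Ř`. The index `0` is the first tensor factor. -/
def QuasiRMatrix.univR {A : UnrolledHopf r ℓ ι U} (𝓡 : QuasiRMatrix A) : Hat A (Fin 2) ℂ :=
  cartanMul A (fun z => xiPow ℓ (bil 𝓡.Q (z 0) (z 1))) fun I z =>
    LinearMap.mul' ℂ ℂ
      (TensorProduct.map (A.coef (I 0) (z 0)) (A.coef (I 1) (z 1)) (𝓡.R : U ⊗[ℂ] U))

/-! ### Weight modules -/

/-- A weight module over `𝒰^H`, that is, a finite dimensional module on which `𝔥` is
diagonalizable and `K^a` acts by `ξ^{H_a}`, with a chosen basis `e` of weight vectors. -/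
structure WeightModule (A : UnrolledHopf r ℓ ι U) where
  V : Type
  [grp : AddCommGroup V]
  [mod : Module ℂ V]
  /-- the action of `U` -/
  rep : U →ₐ[ℂ] Module.End ℂ V
  /-- the action of the elements `H_i` -/
  H : Fin r → Module.End ℂ V
  dim : ℕ
  e : Basis (Fin dim) ℂ V
  /-- the weights of the basis vectors -/
  weight : Fin dim → Fin r → ℂ
  H_apply : ∀ i a, H i (e a) = weight a i • e a
  H_comm : ∀ i j, H i * rep (A.w j) = rep (A.w j) * (H i + algebraMap ℂ _ (A.wt j i : ℂ))
  K_apply : ∀ b a, rep (A.Kadd b) (e a) = xiPow ℓ (pair b (weight a)) • e a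

attribute [instance] WeightModule.grp WeightModule.mod

/-- The matrix coefficient of `u ∈ U` at the row `a` and the column `b`. -/
def WeightModule.entry {A : UnrolledHopf r ℓ ι U} (V : WeightModule A) (a b : Fin V.dim) :
    U →ₗ[ℂ] ℂ :=
  V.e.coord a ∘ₗ LinearMap.applyₗ (V.e b) ∘ₗ V.rep.toLinearMap

/-- The same with indices in `ℕ`, being zero out of range. -/
def WeightModule.entryNat {A : UnrolledHopf r ℓ ι U} (V : WeightModule A) (u : U) (a b : ℕ) : ℂ :=
  if h : a < V.dim ∧ b < V.dim then V.entry ⟨a, h.1⟩ ⟨b, h.2⟩ u else 0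

/-- The weights, with indices in `ℕ`. -/
def WeightModule.weightNat {A : UnrolledHopf r ℓ ι U} (V : WeightModule A) (a : ℕ) : Fin r → ℂ :=
  if h : a < V.dim then V.weight ⟨a, h⟩ else 0

/-! ### Strand ends and coupon colors -/

/-- The color and the direction of a strand at a horizontal line. The color is `none` for a red
strand and `some V` for a blue strand colored by the weight module `V`. -/
structure Label (A : UnrolledHopf r ℓ ι U) where
  color : Option (WeightModule A)
  up : Bool

/-- A red strand directed upwards. -/
def Label.redUp (A : UnrolledHopf r ℓ ι U) : Label A := ⟨none, true⟩

/-- The dimension of the blue color; red strands do not contribute to the blue evaluation. -/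
def Label.dim {A : UnrolledHopf r ℓ ι U} (x : Label A) : ℕ :=
  match x.color with
  | none => 1
  | some V => V.dim

/-- The action of `U` on `V` for a blue strand directed upwards, and on the dual module `V*`,
in the dual basis, for a blue strand directed downwards. -/
def Label.action {A : UnrolledHopf r ℓ ι U} : (x : Label A) → (a b : Fin x.dim) → U →ₗ[ℂ] ℂ
  | ⟨none, _⟩, _, _ => Coalgebra.counit
  | ⟨some V, true⟩, a, b => V.entry a b
  | ⟨some V, false⟩, a, b => V.entry b a ∘ₗ HopfAlgebra.antipode ℂ

/-- The weights of `V`, respectively of `V*`. -/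
def Label.weight {A : UnrolledHopf r ℓ ι U} : (x : Label A) → (a : Fin x.dim) → Fin r → ℂ
  | ⟨none, _⟩, _ => 0
  | ⟨some V, true⟩, a => V.weight a
  | ⟨some V, false⟩, a => -V.weight a

/-- The index set of the product basis of the tensor product of the colors in a list (of the dual
modules for strands directed downwards). Linear maps between two such tensor products are written as
matrices in the product bases. -/
abbrev State {A : UnrolledHopf r ℓ ι U} (L : List (Label A)) :=
  (p : Fin L.length) → Fin (L.get p).dim

/-- The matrix of the action of `U` on the tensor product of a list of blue colors. -/
def stateAction {A : UnrolledHopf r ℓ ι U} : (L : List (Label A)) → (s t : State L) → U →ₗ[ℂ] ℂ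
  | [], _, _ => Coalgebra.counit
  | x :: L, s, t => LinearMap.mul' ℂ ℂ ∘ₗ
      TensorProduct.map (x.action (s 0) (t 0))
        (stateAction L (fun p => s p.succ) (fun p => t p.succ)) ∘ₗ Coalgebra.comul

/-- For a linear form `M` on `U`, the linear form `u ↦ ⟨coef ⊗ ⋯ ⊗ coef ⊗ M, Δ^{(k+1)} u⟩`. -/
def comulCoef (A : UnrolledHopf r ℓ ι U) (M : U →ₗ[ℂ] ℂ) :
    (k : ℕ) → (Fin k → ι) → (Fin k → Fin r → ℂ) → U →ₗ[ℂ] ℂ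
  | 0, _, _ => M
  | k + 1, I, z => LinearMap.mul' ℂ ℂ ∘ₗ
      TensorProduct.map (A.coef (I 0) (z 0))
        (comulCoef A M k (fun j => I j.succ) (fun j => z j.succ)) ∘ₗ Coalgebra.comul

/-- `u_(1) ⊗ ⋯ ⊗ u_(k) ⊗ ρ_V(u_(k+1))` for `u ∈ U`, where `V` is the tensor product of
the colors in the list `L`. -/
def diagAction {A : UnrolledHopf r ℓ ι U} (k : ℕ) (L : List (Label A)) (u : U) :
    Hat A (Fin k) (Matrix (State L) (State L) ℂ) :=
  fun I z => Matrix.of fun s t => comulCoef A (stateAction L s t) k I z u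

/-- `x ∈ (𝒰^H)^{⊗̂ k} ⊗ Hom(V, V')` has the exponent `(q, l)`, where `q` is an integral quadratic
element and `l ∈ (G')^k`: it lies in `ξ^{q + l} U^{⊗ k} ⊗ Hom(V, V')`, for a representative of
`l`. -/
def IsExponent {A : UnrolledHopf r ℓ ι U} {k : ℕ} {σ τ : Type*}
    (x : Hat A (Fin k) (Matrix σ τ ℂ))
    (q : Matrix (Fin k × Fin r) (Fin k × Fin r) ℤ) (l : Fin k → Fin r → CModZ) : Prop :=
  ∃ l₀ : Fin k → Fin r → ℂ, (∀ j i, cls (l₀ j i) = l j i) ∧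
    x ∈ powerSpace A (fun z => quad q z + lin l₀ z) σ τ

/-- The colors of a coupon with `k` red legs: morphisms
`(L_{ξ^{q + l}} ⊗ Id) ∘ ∑ i, L_{u_i} ⊗ f_i` of `𝒰^H`-modules from `(𝒰^H)^{⊗̂ k} ⊗ V` to
`(𝒰^H)^{⊗̂ k} ⊗ V'`, given by the element `ξ^{q + l} ∑ i, u_i ⊗ f_i`. The module
`V` (respectively `V'`) is the tensor product of the colors of the blue legs at the bottom
(respectively at the top). -/
structure CouponColor (A : UnrolledHopf r ℓ ι U) (k : ℕ) (ins outs : List (Label A)) where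
  val : Hat A (Fin k) (Matrix (State outs) (State ins) ℂ)
  /-- the form of the morphism -/
  exists_exponent : ∃ q l, IsExponent val q l
  /-- the morphism commutes with the action of `U` -/
  map_U : ∀ u : U, hatMul val (diagAction k ins u) = hatMul (diagAction k outs u) val
  /-- the morphism commutes with the action of `𝔥` -/
  map_H : ∀ I z t s, val I z t s ≠ 0 →
    (∑ j, latt (A.wt (I j))) + ∑ p, (outs.get p).weight (t p) = ∑ p, (ins.get p).weight (s p)

/-! ### Diagrams

A planar diagram is cut by horizontal lines into slices, each of which contains one elementary piece
and vertical strands to the left and to the right of it. -/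

/-- Elementary pieces.
* `crossing overLeft x y`: the strand with label `x` goes from the bottom left to the top right, the
  strand with label `y` from the bottom right to the top left; the first one is the upper strand
  if and only if `overLeft` holds.
* `cup c d`, `cap c d`: of color `c`; `d` tells whether the left end is directed upwards.
* `coupon k ins outs`: `k` red legs directed upwards at the left of the bottom and of the top; then
  come the blue legs, `ins` at the bottom and `outs` at the top. -/
inductive Piece (A : UnrolledHopf r ℓ ι U)
  | crossing (overLeft : Bool) (x y : Label A)
  | cup (c : Option (WeightModule A)) (d : Bool)
  | cap (c : Option (WeightModule A)) (d : Bool)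
  | coupon (k : ℕ) (ins outs : List (Label A))
      (blue_ins : ∀ x ∈ ins, x.color ≠ none) (blue_outs : ∀ x ∈ outs, x.color ≠ none)
      (col : CouponColor A k ins outs)

namespace Piece

variable {A : UnrolledHopf r ℓ ι U}

/-- The labels at the bottom of a piece. -/
def bot : Piece A → List (Label A)
  | crossing _ x y => [x, y]
  | cup _ _ => []
  | cap c d => [⟨c, d⟩, ⟨c, !d⟩]
  | coupon k ins _ _ _ _ => List.replicate k (Label.redUp A) ++ ins

/-- The labels at the top of a piece. -/
def top : Piece A → List (Label A)
  | crossing _ x y => [y, x]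
  | cup c d => [⟨c, d⟩, ⟨c, !d⟩]
  | cap _ _ => []
  | coupon k _ outs _ _ _ => List.replicate k (Label.redUp A) ++ outs

/-- The number of beads, one on each strand of the smoothed piece. In a crossing, the bead `0` lies
on the upper strand and the bead `1` on the lower one. In a coupon, the bead `j`
lies on the red strand `j`. -/
def nbeads : Piece A → ℕ
  | crossing _ _ _ => 2
  | cup _ _ => 1
  | cap _ _ => 1
  | coupon k _ _ _ _ _ => k

/-- The ends of the strands of a piece: the positions at its bottom and those at its top. -/
abbrev End (e : Piece A) := Fin e.bot.length ⊕ Fin e.top.length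

/-- The start, with respect to its direction, of the strand which carries a bead. -/
def src : (e : Piece A) → Fin e.nbeads → e.End
  | crossing overLeft x y, j =>
      if overLeft = decide (j.val = 0) then
        (if x.up then Sum.inl ⟨0, by simp [bot]⟩ else Sum.inr ⟨1, by simp [top]⟩)
      else (if y.up then Sum.inl ⟨1, by simp [bot]⟩ else Sum.inr ⟨0, by simp [top]⟩)
  | cup _ d, _ => if d then Sum.inr ⟨1, by simp [top]⟩ else Sum.inr ⟨0, by simp [top]⟩
  | cap _ d, _ => if d then Sum.inl ⟨0, by simp [bot]⟩ else Sum.inl ⟨1, by simp [bot]⟩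
  | coupon k ins _ _ _ _, j => Sum.inl ⟨j.val, by have := j.isLt; simp [bot, nbeads] at *; omega⟩

/-- The end, with respect to its direction, of the strand which carries a bead. -/
def tgt : (e : Piece A) → Fin e.nbeads → e.End
  | crossing overLeft x y, j =>
      if overLeft = decide (j.val = 0) then
        (if x.up then Sum.inr ⟨1, by simp [top]⟩ else Sum.inl ⟨0, by simp [bot]⟩)
      else (if y.up then Sum.inr ⟨0, by simp [top]⟩ else Sum.inl ⟨1, by simp [bot]⟩)
  | cup _ d, _ => if d then Sum.inr ⟨0, by simp [top]⟩ else Sum.inr ⟨1, by simp [top]⟩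
  | cap _ d, _ => if d then Sum.inl ⟨1, by simp [bot]⟩ else Sum.inl ⟨0, by simp [bot]⟩
  | coupon k _ outs _ _ _, j => Sum.inr ⟨j.val, by have := j.isLt; simp [top, nbeads] at *; omega⟩

/-- The sign of a crossing, and zero for other pieces. -/
def sign : Piece A → ℤ
  | crossing overLeft x y =>
      (if overLeft then 1 else -1) * (if x.up then 1 else -1) * (if y.up then 1 else -1)
  | _ => 0

/-- Whether the piece is a coupon. -/
def isCoupon : Piece A → Prop
  | coupon _ _ _ _ _ _ => True
  | _ => False

/-- `(q, l)` is an exponent of the coupon. -/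
def HasExponent : (e : Piece A) → Matrix (Fin e.nbeads × Fin r) (Fin e.nbeads × Fin r) ℤ →
    (Fin e.nbeads → Fin r → CModZ) → Prop
  | coupon _ _ _ _ _ col, q, l => IsExponent col.val q l
  | _, _, _ => False

end Piece

/-- The two beads at a crossing, on the upper and on the lower strand, where `upO` and `upU` tell
whether these are directed upwards. With `ℛ = ∑ a ⊗ b`: the upper strand carries `S^↓(a)`;
the lower strand carries `S^↓(b)` if the upper strand has its bottom end on the left, and
`S^↓(S⁻¹(b))` otherwise. Here `S^↓(x)` is `x` on strands directed upwards, `S(x)`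
on strands directed downwards. -/
def QuasiRMatrix.crossingBeads {A : UnrolledHopf r ℓ ι U} (𝓡 : QuasiRMatrix A)
    (overLeft upO upU : Bool) : Hat A (Fin 2) ℂ :=
  let x₁ := if overLeft then 𝓡.univR else antipodeAt A A.antipodeInv 1 𝓡.univR
  let x₂ := if upU then x₁ else antipodeAt A (HopfAlgebra.antipode ℂ) 1 x₁
  if upO then x₂ else antipodeAt A (HopfAlgebra.antipode ℂ) 0 x₂

/-- The coefficients of the beads placed on a piece. The natural numbers `tops j` and `bots j` are
the basis indices at the positions `j` of its top and of its bottom; they only matter for the blue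
part of a coupon. Caps directed to the right carry `g`, cups directed to the right `g⁻¹`, the other
caps and cups `1`. -/
def Piece.beads {A : UnrolledHopf r ℓ ι U} (𝓡 : QuasiRMatrix A) :
    (e : Piece A) → (Fin e.nbeads → ι) → (Fin e.nbeads → Fin r → ℂ) → (tops bots : ℕ → ℕ) → ℂ
  | .crossing overLeft x y, I, z, _, _ =>
      𝓡.crossingBeads overLeft (if overLeft then x.up else y.up)
        (if overLeft then y.up else x.up) I z
  | .cup _ d, I, z, _, _ =>
      A.coef (I ⟨0, Nat.one_pos⟩) (z ⟨0, Nat.one_pos⟩) (if d then 1 else ((A.pivot⁻¹ : Uˣ) : U))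
  | .cap _ d, I, z, _, _ =>
      A.coef (I ⟨0, Nat.one_pos⟩) (z ⟨0, Nat.one_pos⟩) (if d then (A.pivot : U) else 1)
  | .coupon k ins outs _ _ col, I, z, tops, bots =>
      open Classical in
      if h : (∀ p : Fin outs.length, tops (k + p) < (outs.get p).dim) ∧
          (∀ p : Fin ins.length, bots (k + p) < (ins.get p).dim) then
        col.val I z (fun p => ⟨tops (k + p), h.1 p⟩) (fun p => ⟨bots (k + p), h.2 p⟩)
      else 0

/-- A piece with vertical strands to its left and to its right. -/
structure Slice (A : UnrolledHopf r ℓ ι U) where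
  left : List (Label A)
  piece : Piece A
  right : List (Label A)

/-- The labels at the bottom of a slice. -/
def Slice.bot {A : UnrolledHopf r ℓ ι U} (s : Slice A) : List (Label A) :=
  s.left ++ s.piece.bot ++ s.right

/-- The labels at the top of a slice. -/
def Slice.top {A : UnrolledHopf r ℓ ι U} (s : Slice A) : List (Label A) :=
  s.left ++ s.piece.top ++ s.right

/-- A planar diagram: `T` slices, from the bottom to the top, between `T + 1` horizontal lines. -/
structure Diagram (A : UnrolledHopf r ℓ ι U) where
  T : ℕ
  slice : Fin T → Slice A
  level : Fin (T + 1) → List (Label A)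
  level_bot : ∀ t, level t.castSucc = (slice t).bot
  level_top : ∀ t, level t.succ = (slice t).top

namespace Diagram

variable {A : UnrolledHopf r ℓ ι U} (D : Diagram A)

/-- The points of the diagram on the horizontal lines. -/
abbrev Point := Σ t : Fin (D.T + 1), Fin (D.level t).length

/-- The label of a point. -/
def label (x : D.Point) : Label A := (D.level x.1).get x.2

/-- The point at the position `p` of the bottom of the slice `t`. -/
def lower (t : Fin D.T) (p : Fin (D.slice t).bot.length) : D.Point :=
  ⟨t.castSucc, p.val, by rw [D.level_bot]; exact p.isLt⟩

/-- The point at the position `p` of the top of the slice `t`. -/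
def upper (t : Fin D.T) (p : Fin (D.slice t).top.length) : D.Point :=
  ⟨t.succ, p.val, by rw [D.level_top]; exact p.isLt⟩

/-- The point at an end of a strand of the piece in the slice `t`. -/
def endPoint (t : Fin D.T) : (D.slice t).piece.End → D.Point
  | Sum.inl p => D.lower t ⟨(D.slice t).left.length + p, by
      have := p.isLt; simp only [Slice.bot, List.length_append]; omega⟩
  | Sum.inr p => D.upper t ⟨(D.slice t).left.length + p, by
      have := p.isLt; simp only [Slice.top, List.length_append]; omega⟩

/-- The beads of the diagram. -/
abbrev Bead := Σ t : Fin D.T, Fin (D.slice t).piece.nbeads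

/-- The start of the strand of a piece which carries a bead. -/
def src (b : D.Bead) : D.Point := D.endPoint b.1 ((D.slice b.1).piece.src b.2)

/-- The end of the strand of a piece which carries a bead. -/
def tgt (b : D.Bead) : D.Point := D.endPoint b.1 ((D.slice b.1).piece.tgt b.2)

/-- The vertical strands of the slices. -/
abbrev Vertical := Σ t : Fin D.T, Fin (D.slice t).left.length ⊕ Fin (D.slice t).right.length

/-- The bottom of a vertical strand. -/
def vertLow : D.Vertical → D.Point
  | ⟨t, Sum.inl p⟩ => D.lower t ⟨p, by
      have := p.isLt; simp only [Slice.bot, List.length_append]; omega⟩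
  | ⟨t, Sum.inr p⟩ => D.lower t ⟨(D.slice t).left.length + (D.slice t).piece.bot.length + p, by
      have := p.isLt; simp only [Slice.bot, List.length_append]; omega⟩

/-- The top of a vertical strand. -/
def vertHigh : D.Vertical → D.Point
  | ⟨t, Sum.inl p⟩ => D.upper t ⟨p, by
      have := p.isLt; simp only [Slice.top, List.length_append]; omega⟩
  | ⟨t, Sum.inr p⟩ => D.upper t ⟨(D.slice t).left.length + (D.slice t).piece.top.length + p, by
      have := p.isLt; simp only [Slice.top, List.length_append]; omega⟩

/-- Going from the point `x` to the point `y` through one slice of the diagram in which the coupons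
have been smoothed, along a strand and following its direction. -/
def Step (x y : D.Point) : Prop :=
  (∃ b, D.src b = x ∧ D.tgt b = y) ∨
  (∃ v, (D.label (D.vertLow v)).up = true ∧ D.vertLow v = x ∧ D.vertHigh v = y) ∨
  (∃ v, (D.label (D.vertLow v)).up = false ∧ D.vertHigh v = x ∧ D.vertLow v = y)

/-- The point lies on a blue strand. -/
def IsBlue (x : D.Point) : Prop := (D.label x).color ≠ none

/-- The blue edges: the classes of blue points which are joined by blue strands. -/
def BlueEdge := Quot fun x y : {x : D.Point // D.IsBlue x} => D.Step x y

/-- The blue edge through a blue point. -/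
def blueEdge (x : D.Point) (hx : D.IsBlue x) : D.BlueEdge := Quot.mk _ ⟨x, hx⟩

instance : Finite D.BlueEdge := Quot.finite _

instance : Fintype D.BlueEdge := Fintype.ofFinite _

/-- The coupons of the diagram. -/
abbrev Coupon := {t : Fin D.T // (D.slice t).piece.isCoupon}

instance : Fintype D.Coupon := Fintype.ofFinite _

/-- The bead, if there is one, on the strand which leaves the point `x`. -/
def beadAt (x : D.Point) : Option D.Bead :=
  open Classical in if h : ∃ b, D.src b = x then some h.choose else none

end Diagram

/-- A diagram of an `n`-string link graph with `m` closed red components, together with a numbering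
of these components and the choice of a base point on each of them. The points of each red
component are listed following its direction; the list of a closed component starts at the
base point. -/
structure StringLinkDiagram (A : UnrolledHopf r ℓ ι U) (m n : ℕ) extends Diagram A where
  bottom : ∃ L : List (Label A), (∀ x ∈ L, x.color ≠ none) ∧
    level 0 = List.replicate n (Label.redUp A) ++ L
  top : ∃ L : List (Label A), (∀ x ∈ L, x.color ≠ none) ∧
    level (Fin.last T) = List.replicate n (Label.redUp A) ++ L
  pts : Fin m ⊕ Fin n → List toDiagram.Point
  red : ∀ c, ∀ x ∈ pts c, ¬ toDiagram.IsBlue x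
  nodup : ∀ c, (pts c).Nodup
  chain : ∀ c, (pts c).IsChain toDiagram.Step
  existsUnique : ∀ x, ¬ toDiagram.IsBlue x → ∃! c, x ∈ pts c
  closed : ∀ j : Fin m, ∃ x y, (pts (Sum.inl j)).head? = some x ∧
    (pts (Sum.inl j)).getLast? = some y ∧ toDiagram.Step y x
  opened : ∀ j : Fin n, ∃ x y, (pts (Sum.inr j)).head? = some x ∧
    (pts (Sum.inr j)).getLast? = some y ∧
    x.1 = 0 ∧ x.2.val = j.val ∧ y.1 = Fin.last T ∧ y.2.val = j.val

namespace StringLinkDiagram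

variable {A : UnrolledHopf r ℓ ι U} {m n : ℕ} (D : StringLinkDiagram A m n)

/-- The beads on a red component, in the order in which they are met. -/
def redBeads (c : Fin m ⊕ Fin n) : List D.Bead := (D.pts c).filterMap D.beadAt

/-- The Cartan variable `h_c`, for the red component `c` through the point `x`. -/
def var (h : Fin m ⊕ Fin n → Fin r → ℂ) (x : D.Point) : Fin r → ℂ :=
  open Classical in ∑ c, if x ∈ D.pts c then h c else 0

/-- A choice of a basis index at each point of the diagram. -/
abbrev States := (x : D.Point) → Fin (D.label x).dim

/-- The point at which the Cartan variable of a bead is evaluated when the beads on each red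
component are multiplied, in the order opposite to the direction, and the beads on the blue
strands act on the blue colors. A bead on a red component `c` is multiplied on its right by the
beads `w (I b')` met before it, whence a shift of `h_c` by their degrees. A bead on a blue strand
acts on a vector whose weight is read at the start of the strand. -/
def evalPoint (I : D.Bead → ι) (s : D.States) (h : Fin m ⊕ Fin n → Fin r → ℂ) (b : D.Bead) :
    Fin r → ℂ :=
  match (D.label (D.src b)).color with
  | none => open Classical in ∑ c, if b ∈ D.redBeads c then
      h c + (((D.redBeads c).takeWhile (fun b' => decide (b' ≠ b))).map
        fun b' => latt (A.wt (I b'))).sum else 0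
  | some V => V.weightNat (s (D.src b))

/-- The coefficient of the beads placed on the whole diagram, for the basis vectors `w (I b)` and
the values `z b` of the Cartan variables. -/
def beadCoef (𝓡 : QuasiRMatrix A) (I : D.Bead → ι) (z : D.Bead → Fin r → ℂ) (s : D.States) : ℂ :=
  ∏ t : Fin D.T, (D.slice t).piece.beads 𝓡 (fun j => I ⟨t, j⟩) (fun j => z ⟨t, j⟩)
    (fun j => if h : j < (D.slice t).piece.top.length then
      (s (D.endPoint t (Sum.inr ⟨j, h⟩))).val else 0)
    (fun j => if h : j < (D.slice t).piece.bot.length then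
      (s (D.endPoint t (Sum.inl ⟨j, h⟩))).val else 0)

/-- The matrix coefficient of the vector `w (I b)` acting on the blue strand of the bead `b`. A red
strand gives the factor one. -/
def blueCoef (I : D.Bead → ι) (s : D.States) (b : D.Bead) : ℂ :=
  match (D.label (D.src b)).color with
  | none => 1
  | some V => V.entryNat (A.w (I b)) (s (D.tgt b)) (s (D.src b))

/-- The element `J_D^b ∈ (𝒰^H)^{⊗̂ (m + n)} ⊗ Hom(V, V')`. The beads on each red component are
multiplied in the order opposite to the direction, starting from the base point if the component is
closed. The blue part is evaluated by contraction of indices, a bead on a blue strand colored by `V`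
acting on `V`, or by the transposed action on `V*` if the strand is directed downwards. -/
def J (𝓡 : QuasiRMatrix A) : Hat A (Fin m ⊕ Fin n)
    (Matrix (State (D.level (Fin.last D.T))) (State (D.level 0)) ℂ) :=
  fun L h => Matrix.of fun t₁ t₀ =>
    ∑ I : D.Bead → ι, ∑ s : D.States,
      open Classical in
      if (∀ p, s ⟨0, p⟩ = t₀ p) ∧ (∀ p, s ⟨Fin.last D.T, p⟩ = t₁ p) ∧
          (∀ v, (s (D.vertLow v)).val = (s (D.vertHigh v)).val) then
        D.beadCoef 𝓡 I (D.evalPoint I s h) s *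
        (∏ c, A.coef (L c) (h c) ((D.redBeads c).map fun b => A.w (I b)).reverse.prod) *
        ∏ b, D.blueCoef I s b
      else 0

/-! ### The exponent -/

/-- Red components and blue edges. -/
abbrev Comp := (Fin m ⊕ Fin n) ⊕ D.BlueEdge

/-- The point `x` lies on the red component or on the blue edge `k`. -/
def On (k : D.Comp) (x : D.Point) : Prop :=
  match k with
  | Sum.inl c => x ∈ D.pts c
  | Sum.inr e => ∃ hx : D.IsBlue x, D.blueEdge x hx = e

/-- The sign of the crossing whose upper strand carries `b` and whose lower strand carries `b'`;
zero if there is no such crossing. -/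
def crossSign (b b' : D.Bead) : ℤ :=
  if b.1 = b'.1 ∧ b.2.val = 0 ∧ b'.2.val = 1 then (D.slice b.1).piece.sign else 0

/-- The linking matrix of the diagram: the entry `(k, s)` is the sum of the signs of the crossings
at which `s` is above `k`. -/
def lk (k s : D.Comp) : ℤ :=
  open Classical in
  ∑ b : D.Bead, ∑ b' : D.Bead, if D.On s (D.src b) ∧ D.On k (D.src b') then D.crossSign b b' else 0

/-- `Q_D = ∑ lk_{ks} Q(h_k, h_s)`, over the red components `k` and `s`. -/
def QD (𝓡 : QuasiRMatrix A) (h : Fin m ⊕ Fin n → Fin r → ℂ) : ℂ :=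
  ∑ k, ∑ s, (D.lk (Sum.inl k) (Sum.inl s) : ℂ) * bil 𝓡.Q (h k) (h s)

/-- The class in `(G')^{m + n}` of `∑ (lk_{ks} + lk_{sk}) Q(β_s, h_k)`, over the red
components `k` and the blue edges `s`. -/
def LDbar (𝓡 : QuasiRMatrix A) (β : D.BlueEdge → Fin r → CModZ) :
    Fin m ⊕ Fin n → Fin r → CModZ :=
  fun k i => ∑ s, (D.lk (Sum.inl k) (Sum.inr s) + D.lk (Sum.inr s) (Sum.inl k)) •
    ∑ j, 𝓡.Q j i • β s j

/-- Exponents for all coupons: the quadratic elements. -/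
abbrev CouponQ := (t : D.Coupon) → Matrix (Fin (D.slice t.1).piece.nbeads × Fin r)
  (Fin (D.slice t.1).piece.nbeads × Fin r) ℤ

/-- Exponents for all coupons: the classes of linear elements. -/
abbrev CouponL := (t : D.Coupon) → Fin (D.slice t.1).piece.nbeads → Fin r → CModZ

/-- `Q_D^c`, the sum over the coupons of `q(h_{i_1}, …, h_{i_k})`, where `i_1, …, i_k` are the red
components through the red legs. -/
def QDc (q : D.CouponQ) (h : Fin m ⊕ Fin n → Fin r → ℂ) : ℂ :=
  ∑ t : D.Coupon, quad (q t) fun j => D.var h (D.src ⟨t.1, j⟩)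

/-- The class in `(G')^{m + n}` of the sum over the coupons of `l(h_{i_1}, …, h_{i_k})`. -/
def LDcbar (l : D.CouponL) : Fin m ⊕ Fin n → Fin r → CModZ :=
  fun c i => open Classical in
    ∑ t : D.Coupon, ∑ j, if D.src ⟨t.1, j⟩ ∈ D.pts c then l t j i else 0

/-- Each blue edge `s` is colored by a homogeneous weight module of degree `β s ∈ G`. -/
def IsHomogeneous (β : D.BlueEdge → Fin r → CModZ) : Prop :=
  ∀ (x : D.Point) (hx : D.IsBlue x) (V : WeightModule A), (D.label x).color = some V →
    ∀ a i, cls (V.weight a i) = β (D.blueEdge x hx) i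

/-- `P_D = Q_D + Q_D^c + L_D + L_D^c`. -/
def P (𝓡 : QuasiRMatrix A) (q : D.CouponQ) (LD LDc : Fin m ⊕ Fin n → Fin r → ℂ)
    (h : Fin m ⊕ Fin n → Fin r → ℂ) : ℂ :=
  D.QD 𝓡 h + D.QDc q h + lin LD h + lin LDc h

end StringLinkDiagram

end

end

end Unrolled

/-!
For fixed basis indices of the beads and fixed states of the blue points, a term of the sum which
defines `J` is a product of a constant, of the basis vectors `w_I` multiplied along each red
component, and of the functions of the Cartan variables contributed by the pieces of the diagram.
The exponent of each function is computed up to *integral affine functions* (`intAffine`), that is,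
up to the exponents of multiples of the elements `K^a`; the span of the functions `ξ^p` with
`p - P` integral affine is `expSpace ℓ P`. It is multiplicative in `P`, and it does not change when
an integral quadratic exponent is translated by elements of `Λ`.

* The beads at a crossing contribute `ξ^{± Q(h_0, h_1)}`, each antipode changing the sign, so that
  the final sign is the sign of the crossing (`beads_mem_expSpace`). Caps and cups contribute
  elements of `ℂ[Λ*]`, coupons `ξ^{q + l}`.
* A bead on a red component `c` is evaluated at `h_c` translated by an element of `Λ`, a bead on a
  blue edge at a weight of its color, whose class is the degree of the edge (`exists_evalPoint`).
  Expanding `± Q(h_0, h_1)` by bilinearity, a crossing of two red strands contributes to `Q_D`,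
  a crossing of a red and a blue strand to `L_D`, and a crossing of two blue strands a constant
  (`sum_crossingExponent_sub_mem_intAffine`). The coupons give `Q_D^c + L_D^c`. Hence the product
  of all functions lies in the space of `P_D` (`beadCoef_mem_expSpace`).
* The product of the `w_I` along a red component is homogeneous, and moving `ξ^{P_D}` to its left
  translates `P_D` by an element of the lattice, which produces only a factor in
  `ℂ[Λ*]^{⊗ (m + n)}` (`mul_prod_coef_smul_mem_powerSpace`).

Two choices of `L_D + L_D^c` differ by a linear element with integral coefficients `a`, whose
exponential is the unit `⊗ K^{a_c}` (`tensorK`).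
-/

namespace Unrolled

/-! ### Integral affine functions and exponential functions -/

/-- The additive group of the functions `∑ a_{b,i} H_{i,b} + c` on `(𝔥*)^B`, with `a_{b,i} ∈ ℤ` and
`c ∈ ℂ`. -/
def intAffine (r : ℕ) (B : Type*) : AddSubgroup ((B → Fin r → ℂ) → ℂ) :=
  AddSubgroup.closure ({f | ∃ b i, f = fun z => z b i} ∪ Set.range fun (c : ℂ) _ => c)

/-- The span of the functions `ξ^p`, where `p` differs from `P` by an integral affine function. -/
noncomputable def expSpace (ℓ : ℤ) {r : ℕ} {B : Type*} (P : (B → Fin r → ℂ) → ℂ) :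
    Submodule ℂ ((B → Fin r → ℂ) → ℂ) :=
  Submodule.span ℂ {f | ∃ p, p - P ∈ intAffine r B ∧ f = fun z => xiPow ℓ (p z)}

section

variable {r : ℕ} {ℓ : ℤ} {B C : Type*}

lemma xiPow_add (x y : ℂ) : xiPow ℓ (x + y) = xiPow ℓ x * xiPow ℓ y := by
  simp only [xiPow, ← Complex.exp_add]
  congr 1
  ring

lemma xiPow_zero : xiPow ℓ 0 = 1 := by simp [xiPow]

lemma coord_mem_intAffine (b : B) (i : Fin r) :
    (fun z : B → Fin r → ℂ => z b i) ∈ intAffine r B :=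
  AddSubgroup.subset_closure (Or.inl ⟨b, i, rfl⟩)

lemma const_mem_intAffine (c : ℂ) : (fun _ : B → Fin r → ℂ => c) ∈ intAffine r B :=
  AddSubgroup.subset_closure (Or.inr ⟨c, rfl⟩)

lemma intAffine_sum {κ : Type*} [Fintype κ] {f : κ → (B → Fin r → ℂ) → ℂ}
    (hf : ∀ k, f k ∈ intAffine r B) : (fun z => ∑ k, f k z) ∈ intAffine r B := by
  have := (intAffine r B).sum_mem (t := Finset.univ) fun k _ => hf k
  convert this using 1
  ext z
  simp

lemma intAffine_intMul (n : ℤ) {f : (B → Fin r → ℂ) → ℂ} (hf : f ∈ intAffine r B) :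
    (fun z => (n : ℂ) * f z) ∈ intAffine r B := by
  convert (intAffine r B).zsmul_mem hf n using 1
  ext z
  simp

lemma intAffine_ite (p : Prop) [Decidable p] {f : (B → Fin r → ℂ) → ℂ}
    (hf : f ∈ intAffine r B) : (fun z => if p then f z else 0) ∈ intAffine r B := by
  split_ifs
  · exact hf
  · exact zero_mem _

lemma pair_mem_intAffine (a : Fin r → ℤ) (b : B) :
    (fun z : B → Fin r → ℂ => pair a (z b)) ∈ intAffine r B :=
  intAffine_sum fun i => intAffine_intMul (a i) (coord_mem_intAffine b i)

/-- Substituting integral affine functions for the variables. -/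
lemma intAffine_comp {φ : (C → Fin r → ℂ) → B → Fin r → ℂ}
    (hφ : ∀ b i, (fun h => φ h b i) ∈ intAffine r C) {f : (B → Fin r → ℂ) → ℂ}
    (hf : f ∈ intAffine r B) : (fun h => f (φ h)) ∈ intAffine r C := by
  induction hf using AddSubgroup.closure_induction with
  | mem x hx =>
    rcases hx with ⟨b, i, rfl⟩ | ⟨c, rfl⟩
    · exact hφ b i
    · exact const_mem_intAffine c
  | zero => exact zero_mem _
  | add x y _ _ hx hy => exact add_mem hx hy
  | neg x _ hx => exact neg_mem hx

/-- Translating the factors of a product of integral affine functions by integers. -/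
lemma mul_add_int_sub_mem_intAffine {f g : (B → Fin r → ℂ) → ℂ} (hf : f ∈ intAffine r B)
    (hg : g ∈ intAffine r B) (m n : ℤ) :
    (fun z => (f z + m) * (g z + n) - f z * g z) ∈ intAffine r B := by
  convert add_mem (add_mem (intAffine_intMul n hf) (intAffine_intMul m hg))
    (const_mem_intAffine (m * n : ℂ)) using 1
  ext z
  simp only [Pi.add_apply]
  ring

lemma exists_pair_of_mem_intAffine [Fintype B] {f : (B → Fin r → ℂ) → ℂ}
    (hf : f ∈ intAffine r B) :
    ∃ (a : B → Fin r → ℤ) (c : ℂ), ∀ z, f z = ∑ b, pair (a b) (z b) + c := by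
  classical
  induction hf using AddSubgroup.closure_induction with
  | mem x hx =>
    rcases hx with ⟨b, i, rfl⟩ | ⟨c, rfl⟩
    · refine ⟨Pi.single b (Pi.single i 1), 0, fun z => ?_⟩
      rw [Finset.sum_eq_single b, pair, Finset.sum_eq_single i]
      · simp
      · intro j _ hj; simp [hj]
      · simp
      · intro b' _ hb; simp [pair, hb]
      · simp
    · exact ⟨0, c, by simp [pair]⟩
  | zero => exact ⟨0, 0, by simp [pair]⟩
  | add x y _ _ hx hy =>
    obtain ⟨a, c, h⟩ := hx
    obtain ⟨a', c', h'⟩ := hy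
    refine ⟨a + a', c + c', fun z => ?_⟩
    simp only [Pi.add_apply, h, h', pair, Int.cast_add, add_mul, Finset.sum_add_distrib]
    ring
  | neg x _ hx =>
    obtain ⟨a, c, h⟩ := hx
    refine ⟨-a, -c, fun z => ?_⟩
    simp only [Pi.neg_apply, h, pair, Int.cast_neg, neg_mul, Finset.sum_neg_distrib]
    ring

lemma xiPow_mem_expSpace {p P : (B → Fin r → ℂ) → ℂ} (h : p - P ∈ intAffine r B) :
    (fun z => xiPow ℓ (p z)) ∈ expSpace ℓ P :=
  Submodule.subset_span ⟨p, h, rfl⟩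

lemma expSpace_mono {P P' : (B → Fin r → ℂ) → ℂ} (h : P - P' ∈ intAffine r B) :
    expSpace ℓ P ≤ expSpace ℓ P' := by
  refine Submodule.span_le.2 ?_
  rintro _ ⟨p, hp, rfl⟩
  exact xiPow_mem_expSpace (by simpa using add_mem hp h)

lemma const_mem_expSpace (c : ℂ) : (fun _ => c) ∈ expSpace ℓ (0 : (B → Fin r → ℂ) → ℂ) := by
  have := (expSpace ℓ (0 : (B → Fin r → ℂ) → ℂ)).smul_mem c
    (xiPow_mem_expSpace (p := 0) (by simp [zero_mem]))
  convert this using 1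
  ext z
  simp [xiPow_zero]

lemma mul_mem_expSpace {P P' f g : (B → Fin r → ℂ) → ℂ} (hf : f ∈ expSpace ℓ P)
    (hg : g ∈ expSpace ℓ P') : f * g ∈ expSpace ℓ (P + P') := by
  induction hf, hg using Submodule.span_induction₂ with
  | mem_mem x y hx hy =>
    obtain ⟨p, hp, rfl⟩ := hx
    obtain ⟨p', hp', rfl⟩ := hy
    have := xiPow_mem_expSpace (ℓ := ℓ) (p := p + p') (P := P + P')
      (by simpa [add_sub_add_comm] using add_mem hp hp')
    simp only [Pi.add_apply, xiPow_add] at this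
    exact this
  | zero_left => rw [zero_mul]; exact zero_mem _
  | zero_right => rw [mul_zero]; exact zero_mem _
  | add_left x y z _ _ _ hx hy => rw [add_mul]; exact add_mem hx hy
  | add_right x y z _ _ _ hx hy => rw [mul_add]; exact add_mem hx hy
  | smul_left c x y _ _ hx => rw [smul_mul_assoc]; exact Submodule.smul_mem _ c hx
  | smul_right c x y _ _ hx => rw [mul_smul_comm]; exact Submodule.smul_mem _ c hx

lemma prod_mem_expSpace {κ : Type*} (s : Finset κ) {f P : κ → (B → Fin r → ℂ) → ℂ}
    (hf : ∀ k ∈ s, f k ∈ expSpace ℓ (P k)) :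
    (fun z => ∏ k ∈ s, f k z) ∈ expSpace ℓ (fun z => ∑ k ∈ s, P k z) := by
  classical
  induction s using Finset.induction_on with
  | empty => exact const_mem_expSpace 1
  | insert k s hk ih =>
    have := mul_mem_expSpace (hf k (Finset.mem_insert_self k s))
      (ih fun j hj => hf j (Finset.mem_insert_of_mem hj))
    simp only [Finset.prod_insert hk, Finset.sum_insert hk]
    exact this

lemma expSpace_comp {φ : (C → Fin r → ℂ) → B → Fin r → ℂ}
    (hφ : ∀ b i, (fun h => φ h b i) ∈ intAffine r C) {P f : (B → Fin r → ℂ) → ℂ}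
    (hf : f ∈ expSpace ℓ P) : (fun h => f (φ h)) ∈ expSpace ℓ fun h => P (φ h) := by
  induction hf using Submodule.span_induction with
  | mem x hx =>
    obtain ⟨p, hp, rfl⟩ := hx
    exact xiPow_mem_expSpace (p := fun h => p (φ h)) (intAffine_comp hφ hp)
  | zero => exact zero_mem _
  | add x y _ _ hx hy => exact add_mem hx hy
  | smul c x _ hx => exact Submodule.smul_mem _ c hx

lemma differentiable_of_mem_intAffine [Fintype B] {f : (B → Fin r → ℂ) → ℂ}
    (hf : f ∈ intAffine r B) : Differentiable ℂ f := by
  obtain ⟨a, c, h⟩ := exists_pair_of_mem_intAffine hf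
  rw [funext h]
  unfold pair
  fun_prop

lemma differentiable_of_mem_expSpace [Fintype B] {P f : (B → Fin r → ℂ) → ℂ}
    (hP : Differentiable ℂ P) (hf : f ∈ expSpace ℓ P) : Differentiable ℂ f := by
  induction hf using Submodule.span_induction with
  | mem x hx =>
    obtain ⟨p, hp, rfl⟩ := hx
    have hp' : Differentiable ℂ p := by
      simpa using (differentiable_of_mem_intAffine hp).add hP
    unfold xiPow
    fun_prop
  | zero => exact differentiable_const 0
  | add x y _ _ hx hy => exact hx.add hy
  | smul c x _ hx => exact hx.const_smul c

/-- The additive group of the functions which change by an integral affine function under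
translations by `Λ^B`. It contains the integral quadratic elements and all linear elements. -/
def shiftStable (r : ℕ) (B : Type*) : AddSubgroup ((B → Fin r → ℂ) → ℂ) where
  carrier := {P | ∀ d : B → Fin r → ℤ,
    (fun z => P (fun b => z b + latt (d b)) - P z) ∈ intAffine r B}
  zero_mem' d := by simpa using const_mem_intAffine 0
  add_mem' {f g} hf hg d := by
    convert add_mem (hf d) (hg d) using 1
    ext z
    simp only [Pi.add_apply]
    ring
  neg_mem' {f} hf d := by
    convert neg_mem (hf d) using 1
    ext z
    simp only [Pi.neg_apply]
    ring

lemma shiftStable_sum {κ : Type*} [Fintype κ] {f : κ → (B → Fin r → ℂ) → ℂ}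
    (hf : ∀ k, f k ∈ shiftStable r B) : (fun z => ∑ k, f k z) ∈ shiftStable r B := by
  have := (shiftStable r B).sum_mem (t := Finset.univ) fun k _ => hf k
  convert this using 1
  ext z
  simp

lemma exists_int_shift_of_mem_intAffine [Fintype B] {f : (B → Fin r → ℂ) → ℂ}
    (hf : f ∈ intAffine r B) (d : B → Fin r → ℤ) :
    ∃ n : ℤ, ∀ z, f (fun b => z b + latt (d b)) = f z + n := by
  obtain ⟨a, c, h⟩ := exists_pair_of_mem_intAffine hf
  refine ⟨∑ b, ∑ i, a b i * d b i, fun z => ?_⟩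
  simp only [h, pair, latt, Pi.add_apply, mul_add, Finset.sum_add_distrib]
  push_cast
  ring

lemma mul_mem_shiftStable [Fintype B] (n : ℤ) {f g : (B → Fin r → ℂ) → ℂ}
    (hf : f ∈ intAffine r B) (hg : g ∈ intAffine r B) :
    (fun z => (n : ℂ) * f z * g z) ∈ shiftStable r B := by
  intro d
  have hf' := intAffine_intMul n hf
  obtain ⟨m, hm⟩ := exists_int_shift_of_mem_intAffine hf' d
  obtain ⟨n, hn⟩ := exists_int_shift_of_mem_intAffine hg d
  simpa only [hm, hn] using mul_add_int_sub_mem_intAffine hf' hg m n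

lemma lin_mem_shiftStable [Fintype B] (l : B → Fin r → ℂ) : lin l ∈ shiftStable r B := by
  intro d
  convert const_mem_intAffine (lin l fun b => latt (d b)) using 1
  ext z
  simp [lin, mul_add, Finset.sum_add_distrib]

lemma quad_comp_mem_shiftStable [Fintype B] [Fintype C] (M : Matrix (B × Fin r) (B × Fin r) ℤ)
    {v : (C → Fin r → ℂ) → B → Fin r → ℂ} (hv : ∀ b i, (fun h => v h b i) ∈ intAffine r C) :
    (fun h => quad M (v h)) ∈ shiftStable r C :=
  shiftStable_sum fun p => shiftStable_sum fun q =>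
    mul_mem_shiftStable (M p q) (hv p.1 p.2) (hv q.1 q.2)

/-- An integral quadratic element changes by an integral affine function under translations
by `Λ^B`, also after a substitution of integral affine functions for the variables. -/
lemma quad_add_int_sub_mem_intAffine [Fintype B] (M : Matrix (B × Fin r) (B × Fin r) ℤ)
    {v : (C → Fin r → ℂ) → B → Fin r → ℂ} (hv : ∀ b i, (fun h => v h b i) ∈ intAffine r C)
    (d : B → Fin r → ℤ) :
    (fun h => quad M (fun b => v h b + latt (d b)) - quad M (v h)) ∈ intAffine r C := by
  simp only [quad, ← Finset.sum_sub_distrib]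
  refine intAffine_sum fun p => intAffine_sum fun q => ?_
  convert intAffine_intMul (M p q) (mul_add_int_sub_mem_intAffine (hv p.1 p.2) (hv q.1 q.2)
    (d p.1 p.2) (d q.1 q.2)) using 1
  ext h
  simp only [Pi.add_apply, latt]
  ring

end

/-! ### Elements of `U` in the completion -/

section

variable {r : ℕ} {ℓ : ℤ} {ι U : Type*} [Fintype ι] [DecidableEq ι] [Ring U] [HopfAlgebra ℂ U]
variable (A : UnrolledHopf r ℓ ι U) {B : Type*}

lemma coef_basis (i : ι) (z : Fin r → ℂ) (p : ι × (Fin r → ℤ)) :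
    A.coef i z (A.basis p) = if p.1 = i then xiPow ℓ (pair p.2 z) else 0 := by
  simp [UnrolledHopf.coef]

lemma basis_eq (i : ι) (a : Fin r → ℤ) : A.basis (i, a) = A.w i * A.Kadd a := A.basis_mul i a

lemma Kadd_add (a b : Fin r → ℤ) : A.Kadd (a + b) = A.Kadd a * A.Kadd b := by
  simp [UnrolledHopf.Kadd, ofAdd_add]

lemma Kadd_zero : A.Kadd 0 = 1 := by simp [UnrolledHopf.Kadd]

lemma Kadd_eq_basis (a : Fin r → ℤ) : A.Kadd a = A.basis (A.one, a) := by
  rw [basis_eq, UnrolledHopf.w, A.basis_one, one_mul]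

/-- Right multiplication by `K^a` is multiplication of the functions by `ξ^a`. -/
lemma coef_mul_Kadd (i : ι) (z : Fin r → ℂ) (u : U) (a : Fin r → ℤ) :
    A.coef i z (u * A.Kadd a) = xiPow ℓ (pair a z) * A.coef i z u := by
  have : A.coef i z ∘ₗ LinearMap.mulRight ℂ (A.Kadd a) = xiPow ℓ (pair a z) • A.coef i z := by
    refine A.basis.ext fun p => ?_
    obtain ⟨j, b⟩ := p
    have h : A.basis (j, b) * A.Kadd a = A.basis (j, b + a) := by
      rw [basis_eq, basis_eq, Kadd_add, mul_assoc]
    simp only [LinearMap.comp_apply, LinearMap.mulRight_apply, h, coef_basis, LinearMap.smul_apply,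
      smul_eq_mul, mul_ite, mul_zero, ← xiPow_add]
    congr 2
    simp only [pair, Pi.add_apply, Int.cast_add, add_mul, Finset.sum_add_distrib]
    ring
  simpa using LinearMap.congr_fun this u

/-- Only basis vectors of the same degree occur in a homogeneous element. -/
lemma coef_eq_zero_of_mem_homPart {lam : Fin r → ℤ} {u : U} (hu : u ∈ homPart A.basis A.wt lam)
    {i : ι} (hi : A.wt i ≠ lam) (z : Fin r → ℂ) : A.coef i z u = 0 := by
  induction hu using Submodule.span_induction with
  | mem x hx =>
    obtain ⟨p, hp, rfl⟩ := hx
    rw [coef_basis, if_neg]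
    rintro rfl
    exact hi hp
  | zero => exact map_zero _
  | add x y _ _ hx hy => rw [map_add, hx, hy, add_zero]
  | smul c x _ hx => rw [map_smul, hx, smul_zero]

lemma basis_mem_homPart (p : ι × (Fin r → ℤ)) :
    A.basis p ∈ homPart A.basis A.wt (A.wt p.1) :=
  Submodule.subset_span ⟨p, rfl, rfl⟩

lemma prod_w_mem_homPart {β : Type*} (I : β → ι) (L : List β) :
    (L.map fun b => A.w (I b)).reverse.prod ∈
      homPart A.basis A.wt (L.map fun b => A.wt (I b)).sum := by
  induction L with
  | nil =>
    have := basis_mem_homPart A (A.one, 0)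
    rwa [A.basis_one, A.wt_one] at this
  | cons b L ih =>
    have := A.mul_mem _ _ _ _ ih (basis_mem_homPart A (I b, 0))
    rw [add_comm] at this
    simpa [UnrolledHopf.w] using this

lemma coef_mem_expSpace (i : ι) (b : B) (u : U) :
    (fun z : B → Fin r → ℂ => A.coef i (z b) u) ∈ expSpace ℓ (0 : (B → Fin r → ℂ) → ℂ) := by
  have hu : u ∈ Submodule.span ℂ (Set.range A.basis) := by simp [A.basis.span_eq]
  induction hu using Submodule.span_induction with
  | mem x hx =>
    obtain ⟨p, rfl⟩ := hx
    simp only [coef_basis]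
    split_ifs
    · exact xiPow_mem_expSpace (p := fun z => pair p.2 (z b))
        (by simpa using pair_mem_intAffine p.2 b)
    · exact zero_mem _
  | zero => simp only [map_zero]; exact zero_mem _
  | add x y _ _ hx hy => simp only [map_add]; exact add_mem hx hy
  | smul c x _ hx => simp only [map_smul]; exact Submodule.smul_mem _ c hx

lemma cartanMul_mem_expSpace {P : (B → Fin r → ℂ) → ℂ} (hP : P ∈ shiftStable r B)
    (I : B → ι) {x : Hat A B ℂ} (hx : (fun z => x I z) ∈ expSpace ℓ (0 : (B → Fin r → ℂ) → ℂ)) :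
    (fun z => cartanMul A (fun z => xiPow ℓ (P z)) x I z) ∈ expSpace ℓ P := by
  have h := mul_mem_expSpace
    (xiPow_mem_expSpace (p := fun z => P fun b => z b + latt (A.wt (I b))) (hP _)) hx
  rwa [add_zero] at h

variable [Fintype B]

lemma toHat_tprod (u : B → U) (I : B → ι) (z : B → Fin r → ℂ) :
    toHat A (PiTensorProduct.tprod ℂ u) I z = ∏ b, A.coef (I b) (z b) (u b) := by
  simp [toHat]

lemma toHat_mem_expSpace (u : ⨂[ℂ] _ : B, U) (I : B → ι) :
    (fun z => toHat A u I z) ∈ expSpace ℓ (0 : (B → Fin r → ℂ) → ℂ) := by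
  induction u using PiTensorProduct.induction_on with
  | smul_tprod c u =>
    have h := prod_mem_expSpace Finset.univ fun b _ => coef_mem_expSpace A (I b) b (u b)
    simp only [Pi.zero_apply, Finset.sum_const_zero] at h
    have hs : (fun z => toHat A (c • PiTensorProduct.tprod ℂ u) I z) =
        c • fun z => ∏ b, A.coef (I b) (z b) (u b) := by
      ext z
      simp [toHat]
    rw [hs]
    exact Submodule.smul_mem _ c h
  | add x y hx hy =>
    convert add_mem hx hy using 1
    ext z
    simp [toHat]

lemma entry_mem_expSpace_of_mem_powerSpace {σ τ : Type*} {P : (B → Fin r → ℂ) → ℂ}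
    (hP : P ∈ shiftStable r B) {x : Hat A B (Matrix σ τ ℂ)} (hx : x ∈ powerSpace A P σ τ)
    (I : B → ι) (s : σ) (t : τ) : (fun z => x I z s t) ∈ expSpace ℓ P := by
  induction hx using Submodule.span_induction with
  | mem x hx =>
    obtain ⟨u, f, rfl⟩ := hx
    have := Submodule.smul_mem _ (f s t)
      (cartanMul_mem_expSpace A hP I (toHat_mem_expSpace A u I))
    convert this using 1
    ext z
    simp [mul_comm]
  | zero => exact zero_mem _
  | add x y _ _ hx hy => exact add_mem hx hy
  | smul c x _ hx => exact Submodule.smul_mem _ c hx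

lemma isEntire_of_mem_powerSpace {σ τ : Type*} {P : (B → Fin r → ℂ) → ℂ}
    (hP : P ∈ shiftStable r B) (hd : Differentiable ℂ P) {x : Hat A B (Matrix σ τ ℂ)}
    (hx : x ∈ powerSpace A P σ τ) : IsEntire x := fun I s t =>
  differentiable_of_mem_expSpace hd (entry_mem_expSpace_of_mem_powerSpace A hP hx I s t)

/-- A tensor product of homogeneous elements, multiplied on the right by a function in
`expSpace ℓ P`. The function is moved to the left by a translation of its variables; since `P`
is stable under translations, this produces a factor `ξ^P`, a constant and an element of
`ℂ[Λ*]^{⊗ B}`. -/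
lemma mul_prod_coef_smul_mem_powerSpace {σ τ : Type*} {P f : (B → Fin r → ℂ) → ℂ}
    (hP : P ∈ shiftStable r B) (hf : f ∈ expSpace ℓ P) {u : B → U} {d : B → Fin r → ℤ}
    (hu : ∀ b, u b ∈ homPart A.basis A.wt (d b)) (M : Matrix σ τ ℂ) :
    (fun I z => (f z * ∏ b, A.coef (I b) (z b) (u b)) • M : Hat A B (Matrix σ τ ℂ)) ∈
      powerSpace A P σ τ := by
  induction hf using Submodule.span_induction with
  | mem x hx =>
    obtain ⟨p, hp, rfl⟩ := hx
    obtain ⟨a, c, hac⟩ := exists_pair_of_mem_intAffine (sub_mem hp (hP d))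
    refine Submodule.subset_span
      ⟨xiPow ℓ c • PiTensorProduct.tprod ℂ fun b => u b * A.Kadd (a b), M, ?_⟩
    funext I z
    congr 1
    have hs : toHat A (xiPow ℓ c • PiTensorProduct.tprod ℂ fun b => u b * A.Kadd (a b)) I z =
        xiPow ℓ c * ∏ b, (xiPow ℓ (pair (a b) (z b)) * A.coef (I b) (z b) (u b)) := by
      simp only [← coef_mul_Kadd]
      rw [← toHat_tprod]
      simp [toHat]
    by_cases hI : ∀ b, A.wt (I b) = d b
    · have hz : p z = P (fun b => z b + latt (d b)) + (c + ∑ b, pair (a b) (z b)) := by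
        have := hac z
        simp only [Pi.sub_apply] at this
        linear_combination this
      have hx : xiPow ℓ (∑ b, pair (a b) (z b)) = ∏ b, xiPow ℓ (pair (a b) (z b)) := by
        simp only [xiPow, ← Complex.exp_sum, Finset.mul_sum, Finset.sum_div]
      simp only [cartanMul, hI, hs, hz, xiPow_add, hx, Finset.prod_mul_distrib]
      ring
    · push Not at hI
      obtain ⟨b, hb⟩ := hI
      -- both sides vanish, since `w_I` does not occur in the product
      have h0 := coef_eq_zero_of_mem_homPart A (hu b) hb (z b)
      rw [cartanMul, hs, Finset.prod_eq_zero (Finset.mem_univ b) h0,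
        Finset.prod_eq_zero (Finset.mem_univ b) (by rw [h0, mul_zero])]
      simp
  | zero => convert zero_mem (powerSpace A P σ τ) using 1; ext; simp
  | add x y _ _ hx hy => convert add_mem hx hy using 1; ext; simp; ring
  | smul c x _ hx => convert Submodule.smul_mem _ c hx using 1; ext; simp; ring

/-! ### The coefficients of the beads -/

variable {A}

/-- The exponent `± Q(h_0, h_1)` of the beads at a crossing; zero for other pieces. -/
noncomputable def crossingExponent (Q : Matrix (Fin r) (Fin r) ℤ) (e : Piece A)
    (z : Fin e.nbeads → Fin r → ℂ) : ℂ :=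
  ∑ j, ∑ j', if j.val = 0 ∧ j'.val = 1 then (e.sign : ℂ) * bil Q (z j) (z j') else 0

lemma bil_mem_shiftStable (Q : Matrix (Fin r) (Fin r) ℤ) (n : ℤ) (b b' : B) :
    (fun z : B → Fin r → ℂ => (n : ℂ) * bil Q (z b) (z b')) ∈ shiftStable r B := by
  simp only [bil, Finset.mul_sum]
  refine shiftStable_sum fun i => shiftStable_sum fun j => ?_
  convert mul_mem_shiftStable (n * Q i j) (coord_mem_intAffine b i) (coord_mem_intAffine b' j)
    using 1
  ext z
  push_cast
  ring

lemma univR_mem_expSpace (𝓡 : QuasiRMatrix A) (I : Fin 2 → ι) :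
    (fun z => 𝓡.univR I z) ∈ expSpace ℓ fun z => ((1 : ℤ) : ℂ) * bil 𝓡.Q (z 0) (z 1) := by
  have h := cartanMul_mem_expSpace A (bil_mem_shiftStable 𝓡.Q 1 (0 : Fin 2) 1) I
    (x := fun I z => LinearMap.mul' ℂ ℂ
      (TensorProduct.map (A.coef (I 0) (z 0)) (A.coef (I 1) (z 1)) (𝓡.R : U ⊗[ℂ] U))) ?_
  · convert h using 1
    simp [QuasiRMatrix.univR]
  · induction (𝓡.R : U ⊗[ℂ] U) using TensorProduct.induction_on with
    | zero => simp only [map_zero]; exact zero_mem _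
    | tmul x y =>
      have := mul_mem_expSpace (coef_mem_expSpace A (I 0) (0 : Fin 2) x)
        (coef_mem_expSpace A (I 1) (1 : Fin 2) y)
      rw [add_zero] at this
      exact this
    | add x y hx hy => simp only [map_add]; exact add_mem hx hy

/-- The antipode on one of two factors changes the sign of the exponent `± Q(h_0, h_1)`. -/
lemma antipodeAt_mem_expSpace (Q : Matrix (Fin r) (Fin r) ℤ) (n : ℤ) (S : U →ₗ[ℂ] U) (b : Fin 2)
    {x : Hat A (Fin 2) ℂ}
    (hx : ∀ I, (fun z => x I z) ∈ expSpace ℓ fun z => (n : ℂ) * bil Q (z 0) (z 1))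
    (I : Fin 2 → ι) :
    (fun z => antipodeAt A S b x I z) ∈
      expSpace ℓ fun z => ((-n : ℤ) : ℂ) * bil Q (z 0) (z 1) := by
  have key : ∀ i ∈ Finset.univ,
      (fun z => A.coef (I b) (z b) (S (A.w i)) *
        x (Function.update I b i) (Function.update z b (-(z b + latt (A.wt (I b)))))) ∈
      expSpace ℓ fun z => ((-n : ℤ) : ℂ) * bil Q (z 0) (z 1) := by
    intro i _
    have h1 := expSpace_comp (φ := fun z => Function.update z b (-(z b + latt (A.wt (I b)))))
      (C := Fin 2) ?_ (hx (Function.update I b i))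
    · have h2 := mul_mem_expSpace (coef_mem_expSpace A (I b) b (S (A.w i))) h1
      rw [zero_add] at h2
      refine expSpace_mono ?_ h2
      set d := A.wt (I b)
      -- the translation by `d` changes the exponent by an integral linear element, which involves
      -- the other factor only
      have h3 : ∀ b' : Fin 2, (fun z : Fin 2 → Fin r → ℂ =>
          ∑ i, ∑ j, ((-n * Q i j * (if b = 0 then d i else d j) : ℤ) : ℂ) *
            z b' (if b = 0 then j else i)) ∈ intAffine r (Fin 2) := fun b' =>
        intAffine_sum fun i => intAffine_sum fun j =>
          intAffine_intMul _ (coord_mem_intAffine b' _)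
      fin_cases b
      · convert h3 1 using 1
        ext z
        simp only [Pi.sub_apply, bil, Finset.mul_sum, ← Finset.sum_sub_distrib]
        refine Finset.sum_congr rfl fun i _ => Finset.sum_congr rfl fun j _ => ?_
        simp [latt]
        ring
      · convert h3 0 using 1
        ext z
        simp only [Pi.sub_apply, bil, Finset.mul_sum, ← Finset.sum_sub_distrib]
        refine Finset.sum_congr rfl fun i _ => Finset.sum_congr rfl fun j _ => ?_
        simp [latt]
        ring
    · intro b' i
      rcases eq_or_ne b' b with rfl | hb
      · convert neg_mem (add_mem (coord_mem_intAffine b' i)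
          (const_mem_intAffine (A.wt (I b') i : ℂ))) using 1
        ext z
        simp [latt]
      · simpa [hb] using coord_mem_intAffine b' i
  convert Submodule.sum_mem _ key using 1
  ext z
  simp [antipodeAt]

lemma crossingBeads_mem_expSpace (𝓡 : QuasiRMatrix A) (o a b : Bool) (I : Fin 2 → ι) :
    (fun z => 𝓡.crossingBeads o a b I z) ∈ expSpace ℓ fun z =>
      (((if o then 1 else -1) * (if a then 1 else -1) * (if b then 1 else -1) : ℤ) : ℂ) *
        bil 𝓡.Q (z 0) (z 1) := by
  have h0 := univR_mem_expSpace 𝓡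
  have h1 := fun n S b (x : Hat A (Fin 2) ℂ) hx I => antipodeAt_mem_expSpace 𝓡.Q n S b (x := x) hx I
  cases o <;> cases a <;> cases b <;> simp only [QuasiRMatrix.crossingBeads] <;>
  first
  | exact h0 I
  | exact h1 _ _ _ _ h0 I
  | exact h1 _ _ _ _ (h1 _ _ _ _ h0) I
  | exact h1 _ _ _ _ (h1 _ _ _ _ (h1 _ _ _ _ h0)) I

lemma beads_mem_expSpace (𝓡 : QuasiRMatrix A) (e : Piece A) (he : ¬ e.isCoupon)
    (I : Fin e.nbeads → ι) (tops bots : ℕ → ℕ) :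
    (fun z => e.beads 𝓡 I z tops bots) ∈ expSpace ℓ (crossingExponent 𝓡.Q e) := by
  cases e with
  | crossing o x y =>
    have h := crossingBeads_mem_expSpace 𝓡 o (if o then x.up else y.up)
      (if o then y.up else x.up) I
    have hs : crossingExponent 𝓡.Q (.crossing o x y) = fun z : Fin 2 → Fin r → ℂ =>
        (((if o then 1 else -1) * (if (if o then x.up else y.up) then 1 else -1) *
          (if (if o then y.up else x.up) then 1 else -1) : ℤ) : ℂ) * bil 𝓡.Q (z 0) (z 1) := by
      ext z
      change ∑ j : Fin 2, ∑ j' : Fin 2, _ = _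
      simp only [Fin.sum_univ_two, Piece.sign]
      cases o <;> cases x.up <;> cases y.up <;> simp
    rw [hs]
    exact h
  | cup c d =>
    have : crossingExponent 𝓡.Q (.cup c d) = 0 := by ext; simp [crossingExponent, Piece.sign]
    rw [this]
    exact coef_mem_expSpace A _ _ _
  | cap c d =>
    have : crossingExponent 𝓡.Q (.cap c d) = 0 := by ext; simp [crossingExponent, Piece.sign]
    rw [this]
    exact coef_mem_expSpace A _ _ _
  | coupon k ins outs h h' col => exact (he trivial).elim

lemma crossingExponent_of_isCoupon (Q : Matrix (Fin r) (Fin r) ℤ) (e : Piece A)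
    (he : e.isCoupon) (z : Fin e.nbeads → Fin r → ℂ) : crossingExponent Q e z = 0 := by
  cases e <;> simp_all [crossingExponent, Piece.isCoupon, Piece.sign]

lemma exists_beads_mem_expSpace_of_hasExponent (𝓡 : QuasiRMatrix A) (e : Piece A)
    (q : Matrix (Fin e.nbeads × Fin r) (Fin e.nbeads × Fin r) ℤ)
    (l : Fin e.nbeads → Fin r → CModZ) (h : e.HasExponent q l) :
    ∃ l₀ : Fin e.nbeads → Fin r → ℂ, (∀ j i, cls (l₀ j i) = l j i) ∧
      ∀ (I : Fin e.nbeads → ι) (tops bots : ℕ → ℕ),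
        (fun z => e.beads 𝓡 I z tops bots) ∈ expSpace ℓ fun z => quad q z + lin l₀ z := by
  cases e with
  | coupon k ins outs hi ho col =>
    obtain ⟨l₀, hl, hx⟩ := h
    refine ⟨l₀, hl, fun I tops bots => ?_⟩
    simp only [Piece.beads]
    split_ifs with hc
    · exact entry_mem_expSpace_of_mem_powerSpace A
        (add_mem (quad_comp_mem_shiftStable q fun b i => coord_mem_intAffine b i)
          (lin_mem_shiftStable l₀)) hx I _ _
    · exact zero_mem _
  | crossing => exact h.elim
  | cup => exact h.elim
  | cap => exact h.elim

end

/-! ### Classes of linear elements -/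

section

variable {r : ℕ} {B : Type*} [Fintype B]

lemma cls_intCast (k : ℤ) : cls (k : ℂ) = 0 :=
  (QuotientAddGroup.eq_zero_iff _).2 ⟨k, by simp⟩

lemma exists_int_of_cls_eq {x y : ℂ} (h : cls x = cls y) : ∃ k : ℤ, y - x = k := by
  obtain ⟨k, hk⟩ := QuotientAddGroup.eq.1 h
  exact ⟨k, by simp at hk; rw [hk]; ring⟩

lemma cls_add (x y : ℂ) : cls (x + y) = cls x + cls y := rfl

lemma cls_sum {κ : Type*} (s : Finset κ) (f : κ → ℂ) : cls (∑ k ∈ s, f k) = ∑ k ∈ s, cls (f k) :=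
  map_sum (QuotientAddGroup.mk' (AddSubgroup.zmultiples (1 : ℂ))) f s

lemma cls_intMul (n : ℤ) (x : ℂ) : cls (n * x) = n • cls x := by
  have := map_zsmul (QuotientAddGroup.mk' (AddSubgroup.zmultiples (1 : ℂ))) n x
  rwa [zsmul_eq_mul] at this

lemma cls_ite (p : Prop) [Decidable p] (x : ℂ) :
    cls (if p then x else 0) = if p then cls x else 0 := by
  split_ifs <;> rfl

lemma lin_add_left (l l' : B → Fin r → ℂ) (z : B → Fin r → ℂ) :
    lin (fun b i => l b i + l' b i) z = lin l z + lin l' z := by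
  simp [lin, add_mul, Finset.sum_add_distrib]

lemma lin_mul_left (x : ℂ) (l : B → Fin r → ℂ) (z : B → Fin r → ℂ) :
    lin (fun b i => x * l b i) z = x * lin l z := by
  simp [lin, mul_assoc, Finset.mul_sum]

lemma lin_sum_left {κ : Type*} [Fintype κ] (l : κ → B → Fin r → ℂ) (z : B → Fin r → ℂ) :
    lin (fun b i => ∑ k, l k b i) z = ∑ k, lin (l k) z := by
  simp only [lin, Finset.sum_mul]
  symm
  rw [Finset.sum_comm]
  exact Finset.sum_congr rfl fun b _ => Finset.sum_comm

lemma exists_lin_eq_of_cls_eq {l l' : B → Fin r → ℂ} (h : ∀ b i, cls (l b i) = cls (l' b i)) :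
    ∃ a : B → Fin r → ℤ, ∀ z, lin l' z = lin l z + ∑ b, pair (a b) (z b) := by
  choose a ha using fun b i => exists_int_of_cls_eq (h b i)
  refine ⟨a, fun z => ?_⟩
  simp only [lin, pair, ← ha, sub_mul, Finset.sum_sub_distrib]
  ring

lemma lin_sub_lin_mem_intAffine {l l' : B → Fin r → ℂ} (h : ∀ b i, cls (l b i) = cls (l' b i)) :
    (fun z => lin l' z - lin l z) ∈ intAffine r B := by
  obtain ⟨a, ha⟩ := exists_lin_eq_of_cls_eq h
  simp only [ha, add_sub_cancel_left]
  exact intAffine_sum fun b => pair_mem_intAffine (a b) b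

lemma bil_add_add (Q : Matrix (Fin r) (Fin r) ℤ) (v v' κ κ' : Fin r → ℂ) :
    bil Q (v + κ) (v' + κ') = bil Q v v' + (bil Q κ v' + bil Q v κ') + bil Q κ κ' := by
  simp only [bil, ← Finset.sum_add_distrib, Pi.add_apply]
  refine Finset.sum_congr rfl fun i _ => Finset.sum_congr rfl fun j _ => ?_
  ring

lemma bil_comm {Q : Matrix (Fin r) (Fin r) ℤ} (hQ : Q.IsSymm) (v v' : Fin r → ℂ) :
    bil Q v v' = bil Q v' v := by
  simp only [bil]
  rw [Finset.sum_comm]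
  refine Finset.sum_congr rfl fun i _ => Finset.sum_congr rfl fun j _ => ?_
  rw [hQ.apply]
  ring

lemma bil_sum_left {κ : Type*} [Fintype κ] (Q : Matrix (Fin r) (Fin r) ℤ) (v : κ → Fin r → ℂ)
    (v' : Fin r → ℂ) : bil Q (∑ k, v k) v' = ∑ k, bil Q (v k) v' := by
  have : ∀ w, bil Q w v' = ∑ i, w i * ∑ j, (Q i j : ℂ) * v' j := fun w => by
    simp only [bil, Finset.mul_sum]
    exact Finset.sum_congr rfl fun i _ => Finset.sum_congr rfl fun j _ => by ring
  simp only [this, Finset.sum_apply, Finset.sum_mul]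
  exact Finset.sum_comm

lemma bil_zero_left (Q : Matrix (Fin r) (Fin r) ℤ) (v : Fin r → ℂ) : bil Q 0 v = 0 := by
  simp [bil]

end

/-! ### Strands and their beads -/

section

variable {r : ℕ} {ℓ : ℤ} {ι U : Type*} [Fintype ι] [DecidableEq ι] [Ring U] [HopfAlgebra ℂ U]
variable {A : UnrolledHopf r ℓ ι U}

/-- The label at an end of a strand of a piece. -/
def Piece.endLabel (e : Piece A) : e.End → Label A
  | Sum.inl p => e.bot.get p
  | Sum.inr p => e.top.get p

/-- The strand of a bead starts at the bottom if it is directed upwards there, at the top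
otherwise. -/
lemma Piece.up_endLabel_src (e : Piece A) (j : Fin e.nbeads) :
    (e.endLabel (e.src j)).up = (e.src j).isLeft := by
  cases e with
  | crossing o x y =>
    simp only [Piece.src]
    split_ifs with h1 h2 h2 <;> simpa [Piece.endLabel, Piece.bot, Piece.top] using h2
  | cup c d => cases d <;> simp [Piece.src, Piece.endLabel, Piece.top]
  | cap c d => cases d <;> simp [Piece.src, Piece.endLabel, Piece.bot]
  | coupon k ins outs hi ho col =>
    have := j.isLt
    simp only [Piece.nbeads] at this
    simp [Piece.src, Piece.endLabel, Piece.bot, this, Label.redUp]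

lemma Piece.src_injective (e : Piece A) : Function.Injective e.src := by
  intro j j' h
  cases e with
  | crossing o x y =>
    change Fin 2 at j j'
    fin_cases j <;> fin_cases j' <;> first | rfl | (exfalso; revert h)
    all_goals
      simp only [Piece.src]
      cases o <;> cases x.up <;> cases y.up <;> simp
  | cup c d => exact Subsingleton.elim (α := Fin 1) j j'
  | cap c d => exact Subsingleton.elim (α := Fin 1) j j'
  | coupon k ins outs hi ho col =>
    simp only [Piece.src, Sum.inl.injEq, Fin.mk.injEq] at h
    exact Fin.ext h

lemma Piece.endLabel_src_of_isCoupon (e : Piece A) (he : e.isCoupon) (j : Fin e.nbeads) :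
    (e.endLabel (e.src j)).color = none := by
  cases e with
  | coupon k ins outs hi ho col =>
    have := j.isLt
    simp only [Piece.nbeads] at this
    simp [Piece.src, Piece.endLabel, Piece.bot, this, Label.redUp]
  | _ => exact he.elim

namespace Diagram

variable (D : Diagram A)

lemma label_lower (t : Fin D.T) (p : Fin (D.slice t).bot.length) :
    D.label (D.lower t p) = (D.slice t).bot.get p := by
  have h := D.level_bot t
  simp only [label, lower, List.get_eq_getElem]
  congr 1

lemma label_upper (t : Fin D.T) (p : Fin (D.slice t).top.length) :
    D.label (D.upper t p) = (D.slice t).top.get p := by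
  have h := D.level_top t
  simp only [label, upper, List.get_eq_getElem]
  congr 1

lemma label_endPoint (t : Fin D.T) (x : (D.slice t).piece.End) :
    D.label (D.endPoint t x) = (D.slice t).piece.endLabel x := by
  rcases x with p | p
  · rw [endPoint, label_lower]
    simp [Slice.bot, Piece.endLabel]
  · rw [endPoint, label_upper]
    simp [Slice.top, Piece.endLabel]

lemma up_label_src (b : D.Bead) :
    (D.label (D.src b)).up = ((D.slice b.1).piece.src b.2).isLeft := by
  rw [src, label_endPoint, Piece.up_endLabel_src]

/-- A strand with a bead is determined by its start: the direction at this point tells on which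
side of the horizontal line the strand lies. -/
lemma src_injective : Function.Injective D.src := by
  rintro ⟨t, j⟩ ⟨t', j'⟩ h
  have hup := congrArg (fun x => (D.label x).up) h
  simp only [up_label_src] at hup
  simp only [src] at h
  have ht : t = t' := by
    have h1 := congrArg (fun x => x.1.val) h
    rcases hs : (D.slice t).piece.src j with p | p <;>
      rcases hs' : (D.slice t').piece.src j' with p' | p' <;>
      simp_all [endPoint, lower, upper, Fin.ext_iff]
  subst ht
  congr 1
  apply Piece.src_injective
  rcases hs : (D.slice t).piece.src j with p | p <;>
    rcases hs' : (D.slice t).piece.src j' with p' | p' <;>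
    simp_all [endPoint, lower, upper, Fin.ext_iff]

lemma beadAt_eq_some_iff (x : D.Point) (b : D.Bead) : D.beadAt x = some b ↔ D.src b = x := by
  unfold beadAt
  constructor
  · intro h
    split_ifs at h with hx
    rw [← Option.some.inj h]
    exact hx.choose_spec
  · intro h
    have hx : ∃ b, D.src b = x := ⟨b, h⟩
    rw [dif_pos hx]
    congr 1
    exact D.src_injective (hx.choose_spec.trans h.symm)

lemma not_isBlue_iff (x : D.Point) : ¬ D.IsBlue x ↔ (D.label x).color = none := by
  simp [IsBlue]

end Diagram

namespace StringLinkDiagram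

variable {m n : ℕ} (D : StringLinkDiagram A m n)

/-- No bead of a red component is missed, since `src` is injective. -/
lemma mem_redBeads_iff (c : Fin m ⊕ Fin n) (b : D.Bead) :
    b ∈ D.redBeads c ↔ D.src b ∈ D.pts c := by
  simp only [redBeads, List.mem_filterMap, Diagram.beadAt_eq_some_iff]
  constructor
  · rintro ⟨x, hx, rfl⟩; exact hx
  · intro h; exact ⟨_, h, rfl⟩

lemma var_eq_zero_of_isBlue {x : D.Point} (hx : D.IsBlue x) (h : Fin m ⊕ Fin n → Fin r → ℂ) :
    D.var h x = 0 := by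
  unfold var
  exact Finset.sum_eq_zero fun c _ => if_neg fun hc => D.red c x hc hx

lemma var_apply (h : Fin m ⊕ Fin n → Fin r → ℂ) (x : D.Point) (i : Fin r) :
    D.var h x i = open Classical in ∑ c, if x ∈ D.pts c then h c i else 0 := by
  simp only [var, Finset.sum_apply]
  exact Finset.sum_congr rfl fun c _ => by split_ifs <;> rfl

lemma var_mem_intAffine (x : D.Point) (i : Fin r) :
    (fun h => D.var h x i) ∈ intAffine r (Fin m ⊕ Fin n) := by
  classical
  simp only [var_apply]
  exact intAffine_sum fun c => intAffine_ite _ (coord_mem_intAffine c i)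

/-- The class in `G` of the constant part of the Cartan variable of a bead: zero for
a red bead, the degree of the color for a blue bead. -/
noncomputable def beadClass (β : D.BlueEdge → Fin r → CModZ) (b : D.Bead) (i : Fin r) : CModZ :=
  open Classical in ∑ s, if D.On (Sum.inr s) (D.src b) then β s i else 0

lemma beadClass_of_isBlue (β : D.BlueEdge → Fin r → CModZ) {b : D.Bead}
    (hb : D.IsBlue (D.src b)) (i : Fin r) : D.beadClass β b i = β (D.blueEdge _ hb) i := by
  classical
  rw [beadClass, Finset.sum_eq_single (D.blueEdge _ hb)]
  · exact if_pos ⟨hb, rfl⟩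
  · intro s _ hs
    exact if_neg fun ⟨_, h⟩ => hs h.symm
  · simp

lemma beadClass_of_not_isBlue (β : D.BlueEdge → Fin r → CModZ) {b : D.Bead}
    (hb : ¬ D.IsBlue (D.src b)) (i : Fin r) : D.beadClass β b i = 0 := by
  rw [beadClass]
  exact Finset.sum_eq_zero fun s _ => if_neg fun ⟨h, _⟩ => hb h

/-- The Cartan variable of a red bead is the one of its component up to a translation by `Λ`. -/
lemma exists_evalPoint_of_red (I : D.Bead → ι) (s : D.States) (b : D.Bead)
    (hb : (D.label (D.src b)).color = none) : ∃ d : Fin r → ℤ, ∀ h,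
      D.evalPoint I s h b = D.var h (D.src b) + latt d := by
  classical
  obtain ⟨c, hc, huniq⟩ := D.existsUnique (D.src b) ((D.not_isBlue_iff _).2 hb)
  have hlatt : ∀ L : List D.Bead, ∃ d : Fin r → ℤ,
      (L.map fun b' => latt (A.wt (I b'))).sum = latt d := by
    intro L
    refine ⟨(L.map fun b' => A.wt (I b')).sum, ?_⟩
    induction L with
    | nil => ext; simp [latt]
    | cons b L ih => rw [List.map_cons, List.sum_cons, ih]; ext; simp [latt]
  obtain ⟨d, hd⟩ := hlatt ((D.redBeads c).takeWhile fun b' => decide (b' ≠ b))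
  refine ⟨d, fun h => ?_⟩
  have hv : D.var h (D.src b) = h c := by
    rw [var, Finset.sum_eq_single c, if_pos hc]
    · intro c' _ hc'; exact if_neg fun hx => hc' (huniq c' hx)
    · simp
  unfold evalPoint
  split
  · rw [Finset.sum_eq_single c, if_pos ((D.mem_redBeads_iff c b).2 hc), hv, ← hd]
    · intro c' _ hc'
      exact if_neg fun hx => hc' (huniq c' ((D.mem_redBeads_iff c' b).1 hx))
    · simp
  · simp_all

/-- The Cartan variable of a bead is the one of its component, if it is red, up to the addition of
a constant of known class. -/
lemma exists_evalPoint (β : D.BlueEdge → Fin r → CModZ) (hβ : D.IsHomogeneous β)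
    (I : D.Bead → ι) (s : D.States) (b : D.Bead) : ∃ κ : Fin r → ℂ,
      (∀ i, cls (κ i) = D.beadClass β b i) ∧ ∀ h,
      D.evalPoint I s h b = D.var h (D.src b) + κ := by
  by_cases hb : D.IsBlue (D.src b)
  · obtain ⟨V, hV⟩ := Option.ne_none_iff_exists'.1 hb
    refine ⟨V.weightNat (s (D.src b)), fun i => ?_, fun h => ?_⟩
    · have hs : (s (D.src b)).val < V.dim := by
        have := (s (D.src b)).isLt
        simpa only [Label.dim, hV] using this
      rw [beadClass_of_isBlue D β hb, WeightModule.weightNat, dif_pos hs]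
      exact hβ _ hb V hV _ i
    · rw [var_eq_zero_of_isBlue D hb, zero_add]
      unfold evalPoint
      split
      · simp_all
      · rename_i V' hV'
        rw [hV] at hV'
        rw [Option.some.inj hV']
  · obtain ⟨d, hd⟩ := D.exists_evalPoint_of_red I s b ((D.not_isBlue_iff _).1 hb)
    exact ⟨latt d, fun i => by rw [D.beadClass_of_not_isBlue β hb]; exact cls_intCast _, hd⟩

lemma evalPoint_mem_intAffine (β : D.BlueEdge → Fin r → CModZ) (hβ : D.IsHomogeneous β)
    (I : D.Bead → ι) (s : D.States) (b : D.Bead) (i : Fin r) :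
    (fun h => D.evalPoint I s h b i) ∈ intAffine r (Fin m ⊕ Fin n) := by
  obtain ⟨κ, -, hκ⟩ := D.exists_evalPoint β hβ I s b
  simp only [hκ]
  exact add_mem (D.var_mem_intAffine (D.src b) i) (const_mem_intAffine (κ i))

end StringLinkDiagram

end

/-! ### The exponent of the product of the beads -/

/-- Sorting by pairs of beads a sum over components which is weighted by linking numbers. -/
lemma sum_sum_ite_add_smul {S β G : Type*} [Fintype S] [Fintype β] [AddCommGroup G]
    (On : S → β → Prop) (p : β → Prop) (σ : β → β → ℤ) (X : S → G) :
    (open Classical in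
    ∑ s, ((∑ b, ∑ b', if On s b ∧ p b' then σ b b' else 0) +
      ∑ b, ∑ b', if p b ∧ On s b' then σ b b' else 0) • X s =
    ∑ b, ∑ b', σ b b' • ((if p b' then ∑ s, if On s b then X s else 0 else 0) +
      if p b then ∑ s, if On s b' then X s else 0 else 0)) := by
  classical
  have h1 : ∀ b b', (if p b' then ∑ s, if On s b then X s else 0 else 0) =
      ∑ s, if On s b ∧ p b' then X s else 0 := by
    intro b b'
    by_cases h : p b' <;> simp [h]
  simp only [h1, add_smul, smul_add, Finset.sum_add_distrib, Finset.sum_smul, Finset.smul_sum]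
  congr 1
  · rw [Finset.sum_comm]
    refine Finset.sum_congr rfl fun b _ => ?_
    rw [Finset.sum_comm]
    refine Finset.sum_congr rfl fun b' _ => Finset.sum_congr rfl fun s _ => ?_
    split_ifs <;> simp
  · rw [Finset.sum_comm]
    refine Finset.sum_congr rfl fun b _ => ?_
    rw [Finset.sum_comm]
    refine Finset.sum_congr rfl fun b' _ => Finset.sum_congr rfl fun s _ => ?_
    simp only [and_comm (a := p b)]
    split_ifs <;> simp

namespace StringLinkDiagram

section

variable {r : ℕ} {ℓ : ℤ} {ι U : Type*} [Fintype ι] [DecidableEq ι] [Ring U] [HopfAlgebra ℂ U]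
variable {A : UnrolledHopf r ℓ ι U} {m n : ℕ} (D : StringLinkDiagram A m n)

lemma lin_ite_mem_pts (x : D.Point) (a : Fin r → ℂ) (h : Fin m ⊕ Fin n → Fin r → ℂ) :
    lin (fun c i => open Classical in if x ∈ D.pts c then a i else 0) h =
      ∑ i, a i * D.var h x i := by
  classical
  simp only [lin, var_apply, Finset.mul_sum]
  rw [Finset.sum_comm]
  refine Finset.sum_congr rfl fun i _ => Finset.sum_congr rfl fun c _ => ?_
  split_ifs <;> simp

lemma sum_crossingExponent (Q : Matrix (Fin r) (Fin r) ℤ) (z : D.Bead → Fin r → ℂ) :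
    ∑ t, crossingExponent Q (D.slice t).piece (fun j => z ⟨t, j⟩) =
      ∑ b, ∑ b', (D.crossSign b b' : ℂ) * bil Q (z b) (z b') := by
  simp only [Fintype.sum_sigma]
  refine Finset.sum_congr rfl fun t _ => Finset.sum_congr rfl fun j _ => ?_
  rw [Finset.sum_eq_single t]
  · refine Finset.sum_congr rfl fun j' _ => ?_
    simp only [crossSign, true_and]
    split_ifs <;> simp
  · intro t' _ ht
    refine Finset.sum_eq_zero fun j' _ => ?_
    simp [crossSign, ht.symm]
  · simp

/-- The quadratic exponent, sorted by the pairs of beads at the crossings. -/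
lemma QD_eq (𝓡 : QuasiRMatrix A) (h : Fin m ⊕ Fin n → Fin r → ℂ) :
    D.QD 𝓡 h = ∑ b, ∑ b', (D.crossSign b b' : ℂ) *
      bil 𝓡.Q (D.var h (D.src b)) (D.var h (D.src b')) := by
  classical
  have hb : ∀ b b', bil 𝓡.Q (D.var h (D.src b)) (D.var h (D.src b')) = ∑ k, ∑ s,
      if D.src b ∈ D.pts s ∧ D.src b' ∈ D.pts k then bil 𝓡.Q (h k) (h s) else 0 := by
    intro b b'
    rw [bil_comm 𝓡.symm, var, bil_sum_left]
    refine Finset.sum_congr rfl fun k _ => ?_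
    rw [bil_comm 𝓡.symm, var, bil_sum_left]
    refine Finset.sum_congr rfl fun s _ => ?_
    by_cases h1 : D.src b ∈ D.pts s <;> by_cases h2 : D.src b' ∈ D.pts k <;>
      simp [h1, h2, bil_zero_left, bil_comm 𝓡.symm _ (0 : Fin r → ℂ), bil_comm 𝓡.symm (h s)]
  simp only [QD, lk, hb, Int.cast_sum, Finset.sum_mul, Finset.mul_sum]
  rw [Finset.sum_congr rfl fun k _ => Finset.sum_comm, Finset.sum_comm]
  refine Finset.sum_congr rfl fun b _ => ?_
  rw [Finset.sum_congr rfl fun k _ => Finset.sum_comm, Finset.sum_comm]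
  refine Finset.sum_congr rfl fun b' _ => Finset.sum_congr rfl fun k _ =>
    Finset.sum_congr rfl fun s _ => ?_
  by_cases hc : D.src b ∈ D.pts s ∧ D.src b' ∈ D.pts k
  · have hc' : D.On (Sum.inl s) (D.src b) ∧ D.On (Sum.inl k) (D.src b') := hc
    rw [if_pos hc, if_pos hc']
  · have hc' : ¬ (D.On (Sum.inl s) (D.src b) ∧ D.On (Sum.inl k) (D.src b')) := hc
    rw [if_neg hc, if_neg hc', Int.cast_zero, zero_mul, mul_zero]

/-- The contributions to the linear exponent of the crossings, sorted by the
pairs of beads. -/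
lemma LDbar_eq (𝓡 : QuasiRMatrix A) (β : D.BlueEdge → Fin r → CModZ) (c : Fin m ⊕ Fin n)
    (i : Fin r) : D.LDbar 𝓡 β c i = open Classical in ∑ b, ∑ b', D.crossSign b b' •
      ((if D.src b' ∈ D.pts c then ∑ j, 𝓡.Q j i • D.beadClass β b j else 0) +
        if D.src b ∈ D.pts c then ∑ j, 𝓡.Q j i • D.beadClass β b' j else 0) := by
  classical
  obtain ⟨X, hX⟩ : ∃ X : D.BlueEdge → CModZ, ∀ s, ∑ j, 𝓡.Q j i • β s j = X s :=
    ⟨_, fun _ => rfl⟩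
  have hb : ∀ b, ∑ j, 𝓡.Q j i • D.beadClass β b j =
      ∑ s, if D.On (Sum.inr s) (D.src b) then X s else 0 := by
    intro b
    simp only [beadClass, Finset.smul_sum, ← hX]
    rw [Finset.sum_comm]
    refine Finset.sum_congr rfl fun s _ => ?_
    split_ifs <;> simp
  have h := sum_sum_ite_add_smul (fun s b => D.On (Sum.inr s) (D.src b))
    (fun b => D.src b ∈ D.pts c) D.crossSign X
  simp only [LDbar, hX, hb, lk]
  refine Eq.trans ?_ (h.trans ?_)
  · exact Finset.sum_congr rfl fun s _ => by congr!
  · exact Finset.sum_congr rfl fun b _ => Finset.sum_congr rfl fun b' _ => by congr!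

/-- The exponents of the crossings add up to `Q_D + L_D`, up to an integral affine function. -/
lemma sum_crossingExponent_sub_mem_intAffine (𝓡 : QuasiRMatrix A)
    (β : D.BlueEdge → Fin r → CModZ) (hβ : D.IsHomogeneous β) (I : D.Bead → ι) (s : D.States)
    (LD : Fin m ⊕ Fin n → Fin r → ℂ) (hLD : ∀ c i, cls (LD c i) = D.LDbar 𝓡 β c i) :
    (fun h => ∑ t, crossingExponent 𝓡.Q (D.slice t).piece (fun j => D.evalPoint I s h ⟨t, j⟩) -
      (D.QD 𝓡 h + lin LD h)) ∈ intAffine r (Fin m ⊕ Fin n) := by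
  classical
  choose κ hκ hev using fun b => D.exists_evalPoint β hβ I s b
  -- the linear part of the sum, for the given representatives `κ b` of the degrees
  let L : Fin m ⊕ Fin n → Fin r → ℂ := fun c i => ∑ b, ∑ b', (D.crossSign b b' : ℂ) *
    ((if D.src b' ∈ D.pts c then ∑ j, (𝓡.Q j i : ℂ) * κ b j else 0) +
      if D.src b ∈ D.pts c then ∑ j, (𝓡.Q j i : ℂ) * κ b' j else 0)
  have hL : ∀ c i, cls (LD c i) = cls (L c i) := by
    intro c i
    simp only [hLD, LDbar_eq, L, cls_sum, cls_intMul, cls_add, cls_ite, hκ]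
  have hlin : ∀ h, lin L h = ∑ b, ∑ b', (D.crossSign b b' : ℂ) *
      (bil 𝓡.Q (κ b) (D.var h (D.src b')) + bil 𝓡.Q (D.var h (D.src b)) (κ b')) := by
    intro h
    simp only [L, lin_sum_left, lin_mul_left, lin_add_left, lin_ite_mem_pts]
    have hb : ∀ x y : Fin r → ℂ, bil 𝓡.Q x y = ∑ i, (∑ j, (𝓡.Q j i : ℂ) * x j) * y i := by
      intro x y
      simp only [bil, Finset.sum_mul]
      exact Finset.sum_comm
    refine Finset.sum_congr rfl fun b _ => Finset.sum_congr rfl fun b' _ => ?_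
    rw [bil_comm 𝓡.symm (D.var h (D.src b)), hb, hb]
  convert add_mem (lin_sub_lin_mem_intAffine hL) (const_mem_intAffine
    (∑ b, ∑ b', (D.crossSign b b' : ℂ) * bil 𝓡.Q (κ b) (κ b'))) using 1
  ext h
  rw [D.sum_crossingExponent 𝓡.Q (D.evalPoint I s h), D.QD_eq]
  simp only [Pi.add_apply, hlin, hev, bil_add_add, mul_add, Finset.sum_add_distrib]
  ring

/-- The beads of a coupon are red, so that evaluating them translates the variables by `Λ` only,
which keeps the exponent of the coupon. -/
lemma coupon_beads_mem_expSpace (I : D.Bead → ι) (s : D.States)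
    (t : D.Coupon) {M : Matrix (Fin (D.slice t.1).piece.nbeads × Fin r)
      (Fin (D.slice t.1).piece.nbeads × Fin r) ℤ} {l : Fin (D.slice t.1).piece.nbeads → Fin r → ℂ}
    {f : (Fin (D.slice t.1).piece.nbeads → Fin r → ℂ) → ℂ}
    (hf : f ∈ expSpace ℓ fun z => quad M z + lin l z) :
    (fun h => f fun j => D.evalPoint I s h ⟨t.1, j⟩) ∈ expSpace ℓ fun h =>
      quad M (fun j => D.var h (D.src ⟨t.1, j⟩)) + lin l fun j => D.var h (D.src ⟨t.1, j⟩) := by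
  have hred : ∀ j, (D.label (D.src ⟨t.1, j⟩)).color = none := fun j => by
    rw [Diagram.src, Diagram.label_endPoint]
    exact Piece.endLabel_src_of_isCoupon _ t.2 j
  choose d hd using fun j => D.exists_evalPoint_of_red I s ⟨t.1, j⟩ (hred j)
  have hv := fun j i => D.var_mem_intAffine (D.src ⟨t.1, j⟩) i
  have hev : ∀ j i, (fun h => D.evalPoint I s h ⟨t.1, j⟩ i) ∈ intAffine r (Fin m ⊕ Fin n) := by
    intro j i
    simp only [hd]
    exact add_mem (hv j i) (const_mem_intAffine (latt (d j) i))
  refine expSpace_mono ?_ (expSpace_comp hev hf)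
  convert add_mem (quad_add_int_sub_mem_intAffine M hv d)
    (const_mem_intAffine (lin l fun j => latt (d j))) using 1
  ext h
  simp only [hd, lin, Pi.sub_apply, Pi.add_apply, mul_add, Finset.sum_add_distrib]
  ring

/-- The product of the coefficients of the beads lies in `ξ^{P_D} ℂ[Λ*]^{⊗ (m + n)}`. -/
lemma beadCoef_mem_expSpace (𝓡 : QuasiRMatrix A)
    (β : D.BlueEdge → Fin r → CModZ) (hβ : D.IsHomogeneous β) (q : D.CouponQ) (l : D.CouponL)
    (hql : ∀ t : D.Coupon, (D.slice t.1).piece.HasExponent (q t) (l t))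
    (LD LDc : Fin m ⊕ Fin n → Fin r → ℂ) (hLD : ∀ c i, cls (LD c i) = D.LDbar 𝓡 β c i)
    (hLDc : ∀ c i, cls (LDc c i) = D.LDcbar l c i) (I : D.Bead → ι) (s : D.States) :
    (fun h => D.beadCoef 𝓡 I (D.evalPoint I s h) s) ∈ expSpace ℓ (D.P 𝓡 q LD LDc) := by
  classical
  choose l₀ hl₀ hmem using fun t => exists_beads_mem_expSpace_of_hasExponent 𝓡 _ _ _ (hql t)
  let F : Fin D.T → (Fin m ⊕ Fin n → Fin r → ℂ) → ℂ := fun t h =>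
    if ht : (D.slice t).piece.isCoupon then
      quad (q ⟨t, ht⟩) (fun j => D.var h (D.src ⟨t, j⟩)) +
        lin (l₀ ⟨t, ht⟩) fun j => D.var h (D.src ⟨t, j⟩) else 0
  have hF : ∀ h, ∑ t, F t h = D.QDc q h +
      lin (fun c i => ∑ t : D.Coupon, ∑ j, if D.src ⟨t.1, j⟩ ∈ D.pts c then l₀ t j i else 0) h := by
    intro h
    simp only [lin_sum_left, lin_ite_mem_pts, QDc, ← Finset.sum_add_distrib]
    rw [← Finset.sum_filter_of_ne (p := fun t => (D.slice t).piece.isCoupon)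
      (fun t _ ht => by_contra fun hn => ht (dif_neg hn)),
      Finset.sum_subtype _ (p := fun t => (D.slice t).piece.isCoupon) (by simp)]
    exact Finset.sum_congr rfl fun t _ => dif_pos t.2
  have hprod := prod_mem_expSpace (ℓ := ℓ) Finset.univ
    (f := fun t h => (D.slice t).piece.beads 𝓡 (fun j => I ⟨t, j⟩)
      (fun j => D.evalPoint I s h ⟨t, j⟩)
      (fun j => if h : j < (D.slice t).piece.top.length then
        (s (D.endPoint t (Sum.inr ⟨j, h⟩))).val else 0)
      (fun j => if h : j < (D.slice t).piece.bot.length then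
        (s (D.endPoint t (Sum.inl ⟨j, h⟩))).val else 0))
    (P := fun t h => crossingExponent 𝓡.Q (D.slice t).piece
      (fun j => D.evalPoint I s h ⟨t, j⟩) + F t h) ?_
  · refine expSpace_mono ?_ hprod
    have hc : ∀ c i, cls (LDc c i) = cls (∑ t : D.Coupon, ∑ j,
        if D.src ⟨t.1, j⟩ ∈ D.pts c then l₀ t j i else 0) := by
      intro c i
      simp only [hLDc, LDcbar, cls_sum, cls_ite, hl₀]
    convert add_mem (D.sum_crossingExponent_sub_mem_intAffine 𝓡 β hβ I s LD hLD)
      (lin_sub_lin_mem_intAffine hc) using 1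
    ext h
    simp only [Pi.sub_apply, Pi.add_apply, Finset.sum_add_distrib, hF, P]
    ring
  · intro t _
    by_cases ht : (D.slice t).piece.isCoupon
    · simp only [crossingExponent_of_isCoupon 𝓡.Q _ ht, F, dif_pos ht, zero_add]
      exact D.coupon_beads_mem_expSpace I s ⟨t, ht⟩ (hmem ⟨t, ht⟩ _ _ _)
    · simp only [F, dif_neg ht, add_zero]
      exact expSpace_comp (fun j i => D.evalPoint_mem_intAffine β hβ I s ⟨t, j⟩ i)
        (beads_mem_expSpace 𝓡 _ ht _ _ _)

lemma P_mem_shiftStable (𝓡 : QuasiRMatrix A) (q : D.CouponQ)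
    (LD LDc : Fin m ⊕ Fin n → Fin r → ℂ) :
    D.P 𝓡 q LD LDc ∈ shiftStable r (Fin m ⊕ Fin n) :=
  add_mem (add_mem (add_mem
    (shiftStable_sum fun k => shiftStable_sum fun s => bil_mem_shiftStable 𝓡.Q _ k s)
    (shiftStable_sum fun t => quad_comp_mem_shiftStable (q t)
      fun j i => D.var_mem_intAffine (D.src ⟨t.1, j⟩) i))
    (lin_mem_shiftStable LD)) (lin_mem_shiftStable LDc)

lemma differentiable_P (𝓡 : QuasiRMatrix A) (q : D.CouponQ)
    (LD LDc : Fin m ⊕ Fin n → Fin r → ℂ) : Differentiable ℂ (D.P 𝓡 q LD LDc) := by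
  have hv := fun x i => differentiable_of_mem_intAffine (D.var_mem_intAffine x i)
  unfold P QD QDc quad bil lin
  fun_prop

lemma J_mem_powerSpace (𝓡 : QuasiRMatrix A)
    (β : D.BlueEdge → Fin r → CModZ) (hβ : D.IsHomogeneous β) (q : D.CouponQ) (l : D.CouponL)
    (hql : ∀ t : D.Coupon, (D.slice t.1).piece.HasExponent (q t) (l t))
    (LD LDc : Fin m ⊕ Fin n → Fin r → ℂ) (hLD : ∀ c i, cls (LD c i) = D.LDbar 𝓡 β c i)
    (hLDc : ∀ c i, cls (LDc c i) = D.LDcbar l c i) :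
    D.J 𝓡 ∈ powerSpace A (D.P 𝓡 q LD LDc)
      (State (D.level (Fin.last D.T))) (State (D.level 0)) := by
  classical
  let M : (D.Bead → ι) → D.States →
      Matrix (State (D.level (Fin.last D.T))) (State (D.level 0)) ℂ := fun I s =>
    Matrix.of fun t₁ t₀ => if (∀ p, s ⟨0, p⟩ = t₀ p) ∧ (∀ p, s ⟨Fin.last D.T, p⟩ = t₁ p) ∧
      (∀ v, (s (D.vertLow v)).val = (s (D.vertHigh v)).val) then ∏ b, D.blueCoef I s b else 0
  have hJ : D.J 𝓡 = ∑ I : D.Bead → ι, ∑ s : D.States, fun L h =>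
      (D.beadCoef 𝓡 I (D.evalPoint I s h) s *
        ∏ c, A.coef (L c) (h c) ((D.redBeads c).map fun b => A.w (I b)).reverse.prod) • M I s := by
    funext L h
    ext t₁ t₀
    simp only [J, Matrix.of_apply, Finset.sum_apply, Matrix.sum_apply, Matrix.smul_apply, M,
      smul_eq_mul, mul_ite, mul_zero]
  rw [hJ]
  exact Submodule.sum_mem _ fun I _ => Submodule.sum_mem _ fun s _ =>
    mul_prod_coef_smul_mem_powerSpace A (D.P_mem_shiftStable 𝓡 q LD LDc)
      (D.beadCoef_mem_expSpace 𝓡 β hβ q l hql LD LDc hLD hLDc I s)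
      (fun c => prod_w_mem_homPart A I (D.redBeads c)) (M I s)

end

end StringLinkDiagram

/-! ### Change of representatives -/

section

variable {r : ℕ} {ℓ : ℤ} {ι U : Type*} [Fintype ι] [DecidableEq ι] [Ring U] [HopfAlgebra ℂ U]
variable (A : UnrolledHopf r ℓ ι U) {B : Type*} [Fintype B]

/-- The element `⊗ b, K^{a b}` as a unit of `U^{⊗ B}`. -/
noncomputable def tensorK (a : B → Fin r → ℤ) : (⨂[ℂ] _ : B, U)ˣ where
  val := PiTensorProduct.tprod ℂ fun b => A.Kadd (a b)
  inv := PiTensorProduct.tprod ℂ fun b => A.Kadd (-a b)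
  val_inv := by
    rw [PiTensorProduct.tprod_mul_tprod, PiTensorProduct.one_def]
    congr 1
    ext b
    simp [← Kadd_add, Kadd_zero]
  inv_val := by
    rw [PiTensorProduct.tprod_mul_tprod, PiTensorProduct.one_def]
    congr 1
    ext b
    simp [← Kadd_add, Kadd_zero]

lemma toHat_tensorK (a : B → Fin r → ℤ) :
    toHat A (tensorK A a : ⨂[ℂ] _ : B, U) =
      cartan A (fun h => xiPow ℓ (∑ b, pair (a b) (h b))) := by
  funext I z
  simp only [tensorK, toHat_tprod, Kadd_eq_basis, coef_basis, cartan]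
  split_ifs with hI
  · simp [hI, xiPow, ← Complex.exp_sum, Finset.mul_sum, Finset.sum_div]
  · push Not at hI
    obtain ⟨b, hb⟩ := hI
    exact Finset.prod_eq_zero (Finset.mem_univ b) (if_neg hb.symm)

lemma cartanMul_cartan (F G : (B → Fin r → ℂ) → ℂ) :
    cartanMul A F (cartan A G) = cartan A fun h => F h * G h := by
  funext I z
  simp only [cartanMul, cartan]
  split_ifs with hI
  · congr 2
    ext b i
    simp [hI, A.wt_one, latt]
  · rw [mul_zero]

end

end Unrolled

open Unrolled in
theorem mainTheorem9 {r : ℕ} {ℓ : ℤ} (hℓ : ℓ ≠ 0) {ι U : Type*} [Fintype ι] [DecidableEq ι]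
    [Ring U] [HopfAlgebra ℂ U] (A : UnrolledHopf r ℓ ι U) (𝓡 : QuasiRMatrix A) {m n : ℕ}
    (D : StringLinkDiagram A m n)
    (β : D.BlueEdge → Fin r → CModZ) (hβ : D.IsHomogeneous β)
    (q : D.CouponQ) (l : D.CouponL)
    (hql : ∀ t : D.Coupon, (D.slice t.1).piece.HasExponent (q t) (l t)) :
    -- independence of the representatives, up to a unit of `U^{⊗ (m + n)}`
    (∀ LD LDc LD' LDc' : Fin m ⊕ Fin n → Fin r → ℂ,
      (∀ c i, cls (LD c i) = D.LDbar 𝓡 β c i) → (∀ c i, cls (LDc c i) = D.LDcbar l c i) →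
      (∀ c i, cls (LD' c i) = D.LDbar 𝓡 β c i) → (∀ c i, cls (LDc' c i) = D.LDcbar l c i) →
      ∃ (a : Fin m ⊕ Fin n → Fin r → ℤ) (u : (⨂[ℂ] _ : Fin m ⊕ Fin n, U)ˣ),
        toHat A (u : ⨂[ℂ] _ : Fin m ⊕ Fin n, U) =
          cartan A (fun h => xiPow ℓ (∑ c, pair (a c) (h c))) ∧
        cartan A (fun h => xiPow ℓ (D.P 𝓡 q LD' LDc' h)) =
          cartanMul A (fun h => xiPow ℓ (D.P 𝓡 q LD LDc h))
            (toHat A (u : ⨂[ℂ] _ : Fin m ⊕ Fin n, U))) ∧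
    -- the value of the invariant
    (∀ LD LDc : Fin m ⊕ Fin n → Fin r → ℂ,
      (∀ c i, cls (LD c i) = D.LDbar 𝓡 β c i) → (∀ c i, cls (LDc c i) = D.LDcbar l c i) →
      IsEntire (D.J 𝓡) ∧
      D.J 𝓡 ∈ powerSpace A (D.P 𝓡 q LD LDc)
        (State (D.level (Fin.last D.T))) (State (D.level 0))) := by
  refine ⟨fun LD LDc LD' LDc' h1 h2 h1' h2' => ?_, fun LD LDc h1 h2 => ?_⟩
  · have h : ∀ c i, cls (LD c i + LDc c i) = cls (LD' c i + LDc' c i) := fun c i => by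
      rw [cls_add, cls_add, h1, h2, h1', h2']
    obtain ⟨a, ha⟩ := exists_lin_eq_of_cls_eq h
    simp only [lin_add_left] at ha
    refine ⟨a, tensorK A a, toHat_tensorK A a, ?_⟩
    rw [toHat_tensorK, cartanMul_cartan]
    congr 1
    funext h
    rw [← xiPow_add]
    congr 1
    simp only [StringLinkDiagram.P]
    linear_combination ha h
  · have h := D.J_mem_powerSpace 𝓡 β hβ q l hql LD LDc h1 h2
    exact ⟨isEntire_of_mem_powerSpace A (D.P_mem_shiftStable 𝓡 q LD LDc)
      (D.differentiable_P 𝓡 q LD LDc) h, h⟩
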